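/- For $n\ge 0$ let $\mathfrak{D}_n$ be the set of signed permutations $\pi=\pi_1\cdots\pi_n$ of $[n]$ with an even number of negative entries, put $\pi_{-1}=-\pi_1$, and define $$\mathrm{DES}_D(\pi)=\{i\in\{-1,1,\dots,n-1\}:\pi_i>\pi_{|i|+1}\},$$ $$\mathrm{inv}_D(\pi)=|\{1\le i<j\le n:\pi_i>\pi_j\}|+|\{1\le i<j\le n:-\pi_i>\pi_j\}|.$$ Let $\mathrm{des}_D(\pi)$, $\mathrm{odes}_D(\pi)$, $\mathrm{edes}_D(\pi)$ be the number of all, of the odd, and of the even elements of $\mathrm{DES}_D(\pi)$ (the index $-1$ is odd; for $n\le 1$ we set $\mathrm{DES}_D(\pi)=\emptyset$). Put $$D_n(t,q)=\sum_{\pi\in\mathfrak{D}_n}t^{\mathrm{des}_D(\pi)}q^{\mathrm{inv}_D(\pi)},\qquad D_n(s,t,q)=\sum_{\pi\in\mathfrak{D}_n}s^{\mathrm{edes}_D(\pi)}t^{\mathrm{odes}_D(\pi)}q^{\mathrm{inv}_D(\pi)}.$$ Let $K$ be a field of characteristic different from $2$ and let $s,t,q,M\in K$ with $s\ne 1$,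 $t\neq 1$, $M^2=(1-s)(1-t)$, and $[n]_q=1+q+\dots+q^{n-1}\ne 0$ for all $n\ge 1$ (for instance $s,t,q$ indeterminates over $\mathbb{Q}$ and $K$ an algebraic closure of $\mathbb{Q}(s,t,q)$). Write $[n]_q!=\prod_{i=1}^n[i]_q$ and, as formal power series in $u$ over $K$, $$\mathrm{e}_q(u)=\sum_{n\ge0}\frac{u^n}{[n]_q!},\quad \exp_D(u;q)=\sum_{n\ge 0}\frac{u^n}{D_n(1,q)},$$ $$\cosh_q(u)=\tfrac12(\mathrm{e}_q(u)+\mathrm{e}_q(-u)),\quad \sinh_q(u)=\tfrac12(\mathrm{e}_q(u)-\mathrm{e}_q(-u)),$$ $$\cosh_D(u;q)=\tfrac12(\exp_D(u;q)+\exp_D(-u;q)),\quad \sinh_D(u;q)=\tfrac12(\exp_D(u;q)-\exp_D(-u;q)),$$ $$\mathcal{D}_0=\sum_{k>0}D_{2k}(s,t,q)\frac{u^{2k}}{D_{2k}(1,q)},\qquad \mathcal{D}_1=\sum_{k>0}D_{2k+1}(s,t,q)\frac{u^{2k+1}}{D_{2k+1}(1,q)},$$ $$\mathrm{OD}=ut^2(\cosh_q(Mu)-1)+\frac{(1-t)M}{1-s}(\sinh_D(Mu;q)-Mu)+\frac{2t(1-t)}{M}(\sinh_q(Mu)-Mu),$$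 $$\mathrm{ED}=2t(\cosh_q(Mu)-1)+(1-t)(\cosh_D(Mu;q)-1)+\frac{ut^2(1-s)}{M}\sinh_q(Mu).$$ Here $D_n(1,q)$ denotes the value of $D_n(t,q)$ at $t=1$. Then $D_n(1,q)\neq0$ for all $n\ge 0$, the series $1-(s+t)\cosh_q(Mu)+st\,\mathrm{e}_q(Mu)\mathrm{e}_q(-Mu)$ is invertible, and $$\mathcal{D}_0=\frac{\mathrm{ED}\,(1-t\cosh_q(Mu))+\mathrm{OD}\cdot\frac{t(1-s)}{M}\sinh_q(Mu)}{1-(s+t)\cosh_q(Mu)+st\,\mathrm{e}_q(Mu)\mathrm{e}_q(-Mu)},$$ $$\mathcal{D}_1=\frac{\mathrm{OD}\,(1-s\cosh_q(Mu))+\mathrm{ED}\cdot\frac{s(1-t)}{M}\sinh_q(Mu)}{1-(s+t)\cosh_q(Mu)+st\,\mathrm{e}_q(Mu)\mathrm{e}_q(-Mu)}.$$ -/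

import Mathlib

namespace TypeDEulerian

noncomputable section

/-- A signed permutation of `[n]`, written as the permutation of absolute values together with
the signs of its entries `π_1, …, π_n`. -/
abbrev SignedPerm (n : ℕ) : Type := Equiv.Perm (Fin n) × (Fin n → ℤˣ)

/-- The value `π_i`, for `i` in `{±1, …, ±n}`: if `i > 0` it is the signed entry in position `i`,
and `π_{-i} = -π_i`. (It is `0` for every other integer `i`.) -/
def entry {n : ℕ} (π : SignedPerm n) (i : ℤ) : ℤ :=
  if h : 1 ≤ i.natAbs ∧ i.natAbs ≤ n then
    i.sign * ((π.2 ⟨i.natAbs - 1, by omega⟩ : ℤ) *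
      (((π.1 ⟨i.natAbs - 1, by omega⟩ : Fin n) : ℤ) + 1))
  else 0

/-- The set `𝔇_n` of signed permutations with an even number of negative entries. -/
def typeD (n : ℕ) : Finset (SignedPerm n) :=
  Finset.univ.filter fun π =>
    Even ((Finset.Icc (1 : ℤ) n).filter fun i => entry π i < 0).card

/-- `DES_D(π)`: the `i ∈ {-1, 1, 2, …, n-1}` with `π_i > π_{|i|+1}`. -/
def DES {n : ℕ} (π : SignedPerm n) : Finset ℤ :=
  (Finset.Icc (-1 : ℤ) ((n : ℤ) - 1)).filter fun i => i ≠ 0 ∧ entry π i > entry π (|i| + 1)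

/-- The number `des_D(π)` of type D descents. -/
def des {n : ℕ} (π : SignedPerm n) : ℕ := (DES π).card

/-- The number `odes_D(π)` of type D descents at odd positions (position `-1` is odd). -/
def odes {n : ℕ} (π : SignedPerm n) : ℕ := ((DES π).filter fun i => Odd i).card

/-- The number `edes_D(π)` of type D descents at even positions. -/
def edes {n : ℕ} (π : SignedPerm n) : ℕ := ((DES π).filter fun i => Even i).card

/-- The type D inversion number (Coxeter length)
`inv_D(π) = |{i < j : π_i > π_j}| + |{i < j : -π_i > π_j}|`. -/
def inv {n : ℕ} (π : SignedPerm n) : ℕ :=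
  ((Finset.Icc (1 : ℤ) n ×ˢ Finset.Icc (1 : ℤ) n).filter fun p =>
      p.1 < p.2 ∧ entry π p.1 > entry π p.2).card +
  ((Finset.Icc (1 : ℤ) n ×ˢ Finset.Icc (1 : ℤ) n).filter fun p =>
      p.1 < p.2 ∧ -entry π p.1 > entry π p.2).card

/-- `D_n(t, q) = ∑_{π ∈ 𝔇_n} t^{des_D π} q^{inv_D π}`. -/
def D₂ {K : Type*} [CommSemiring K] (n : ℕ) (t q : K) : K :=
  ∑ π ∈ typeD n, t ^ des π * q ^ inv π

/-- `D_n(s, t, q) = ∑_{π ∈ 𝔇_n} s^{edes_D π} t^{odes_D π} q^{inv_D π}`. -/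
def D₃ {K : Type*} [CommSemiring K] (n : ℕ) (s t q : K) : K :=
  ∑ π ∈ typeD n, s ^ edes π * t ^ odes π * q ^ inv π

/-- `[n]_q = 1 + q + ⋯ + q^{n-1}`. -/
def qNumber {K : Type*} [CommSemiring K] (q : K) (n : ℕ) : K :=
  ∑ i ∈ Finset.range n, q ^ i

/-- `[n]_q! = [1]_q [2]_q ⋯ [n]_q`. -/
def qFactorial {K : Type*} [CommSemiring K] (q : K) (n : ℕ) : K :=
  ∏ i ∈ Finset.Icc 1 n, qNumber q i

open PowerSeries

variable {K : Type*} [Field K]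

/-! All series below are formal power series in the variable `u`, which is `X`; for a series
`f(u)` and a scalar `M`, the series `f(Mu)` is `rescale M f`. -/

/-- `e_q(u) = ∑_n u^n / [n]_q!`. -/
def expq (q : K) : K⟦X⟧ := PowerSeries.mk fun n => 1 / qFactorial q n

/-- `cosh_q(u) = (e_q(u) + e_q(-u)) / 2`. -/
def coshq (q : K) : K⟦X⟧ := C (1 / 2 : K) * (expq q + rescale (-1) (expq q))

/-- `sinh_q(u) = (e_q(u) - e_q(-u)) / 2`. -/
def sinhq (q : K) : K⟦X⟧ := C (1 / 2 : K) * (expq q - rescale (-1) (expq q))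

/-- `exp_D(u; q) = ∑_n u^n / D_n(1, q)`. -/
def expD (q : K) : K⟦X⟧ := PowerSeries.mk fun n => 1 / D₂ n 1 q

/-- `cosh_D(u; q) = (exp_D(u; q) + exp_D(-u; q)) / 2`. -/
def coshD (q : K) : K⟦X⟧ := C (1 / 2 : K) * (expD q + rescale (-1) (expD q))

/-- `sinh_D(u; q) = (exp_D(u; q) - exp_D(-u; q)) / 2`. -/
def sinhD (q : K) : K⟦X⟧ := C (1 / 2 : K) * (expD q - rescale (-1) (expD q))

/-- `𝒟_0 = ∑_{k > 0} D_{2k}(s, t, q) u^{2k} / D_{2k}(1, q)`. -/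
def egfEven (s t q : K) : K⟦X⟧ :=
  PowerSeries.mk fun n => if Even n ∧ 2 ≤ n then D₃ n s t q / D₂ n 1 q else 0

/-- `𝒟_1 = ∑_{k > 0} D_{2k+1}(s, t, q) u^{2k+1} / D_{2k+1}(1, q)`. -/
def egfOdd (s t q : K) : K⟦X⟧ :=
  PowerSeries.mk fun n => if Odd n ∧ 3 ≤ n then D₃ n s t q / D₂ n 1 q else 0

/-- `OD = u t² (cosh_q(Mu) - 1) + ((1-t)M/(1-s)) (sinh_D(Mu; q) - Mu)
  + (2t(1-t)/M) (sinh_q(Mu) - Mu)`. -/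
def OD (s t q M : K) : K⟦X⟧ :=
  X * C (t ^ 2) * (rescale M (coshq q) - 1) +
  C ((1 - t) * M / (1 - s)) * (rescale M (sinhD q) - C M * X) +
  C (2 * t * (1 - t) / M) * (rescale M (sinhq q) - C M * X)

/-- `ED = 2t (cosh_q(Mu) - 1) + (1-t) (cosh_D(Mu; q) - 1) + (u t² (1-s)/M) sinh_q(Mu)`. -/
def ED (s t q M : K) : K⟦X⟧ :=
  C (2 * t) * (rescale M (coshq q) - 1) +
  C (1 - t) * (rescale M (coshD q) - 1) +
  X * C (t ^ 2 * (1 - s) / M) * rescale M (sinhq q)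

/-- The common denominator `1 - (s+t) cosh_q(Mu) + s t e_q(Mu) e_q(-Mu)`. -/
def den (s t q M : K) : K⟦X⟧ :=
  1 - C (s + t) * rescale M (coshq q) +
  C (s * t) * (rescale M (expq q) * rescale (-M) (expq q))

end

end TypeDEulerian

namespace TypeDEulerian

open Finset

/-! Changing the sign of the entry ±1 preserves every comparison that enters `inv` and the descent
weights, and it exchanges `typeD n` with its complement. Sums over type D are therefore half of sums
over all signed permutations, where entries can be appended and first entries negated freely.

The core is a recurrence for `D₃ n s t q / D₂ n 1 q`. Give each position i the weight x_i (s or t,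
by parity) for a descent and write x^[descent] = x + (1 - x)[ascent]. Expanding from the right, each
prefix of length k with weight x_k is followed by an increasing run. Two facts evaluate the
resulting sums: sorting the last n - k entries divides a sum by `qFactorial q (n - k)` (`sum_asc`),
and the normalized sum of a weight that sees only the first k entries does not depend on n
(`sum_weight`). The positions -1 and 1 are expanded together in `sum_asc_weight_two`, which yields
the three inhomogeneous terms.

In `D₃_div_D₂` the factors 1 - x_i along a run pair up to powers of M² = (1 - s)(1 - t), with one
factor left over when the run has odd length. Separating parities turns the recurrence into two
linear equations for `egfEven` and `egfOdd`, with coefficients built from cosh_q and sinh_q; `den`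
is the determinant of this system, and Cramer's rule gives the formulas. -/

/-! ### Inversions and descents as sums and products over positions -/

/-- The entries of a signed permutation as a function on positions counted from `0`. -/
def val {n : ℕ} (π : SignedPerm n) (i : Fin n) : ℤ := (π.2 i : ℤ) * (((π.1 i : Fin n) : ℤ) + 1)

/-- The entries of a signed permutation as a sequence counted from `0` and continued by `0`. -/
def word {n : ℕ} (π : SignedPerm n) (i : ℕ) : ℤ := if h : i < n then val π ⟨i, h⟩ else 0

theorem word_of_lt {n : ℕ} (π : SignedPerm n) {i : ℕ} (h : i < n) : word π i = val π ⟨i, h⟩ := by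
  simp [word, h]

theorem word_fin {n : ℕ} (π : SignedPerm n) (i : Fin n) : word π i = val π i :=
  word_of_lt π i.2

theorem abs_val {n : ℕ} (π : SignedPerm n) (i : Fin n) : |val π i| = ((π.1 i : Fin n) : ℤ) + 1 := by
  have h : |((π.2 i : ℤˣ) : ℤ)| = 1 := by
    rcases Int.units_eq_one_or (π.2 i) with h | h <;> simp [h]
  rw [val, abs_mul, h, one_mul]
  exact abs_of_nonneg (by omega)

theorem abs_val_injective {n : ℕ} (π : SignedPerm n) : Function.Injective fun i => |val π i| := by
  intro i j h
  simp only [abs_val] at h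
  apply π.1.injective
  ext
  omega

theorem val_ne {n : ℕ} (π : SignedPerm n) {i j : Fin n} (h : i ≠ j) : val π i ≠ val π j :=
  fun e => h (abs_val_injective π (congrArg abs e))

theorem neg_val_ne {n : ℕ} (π : SignedPerm n) {i j : Fin n} (h : i ≠ j) : -val π i ≠ val π j :=
  fun e => h (abs_val_injective π (by simp [← e]))

theorem word_ne {n : ℕ} (π : SignedPerm n) {i j : ℕ} (hi : i < n) (hj : j < n) (h : i ≠ j) :
    word π i ≠ word π j := by
  rw [word_of_lt π hi, word_of_lt π hj]
  exact val_ne π (by simpa using h)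

theorem neg_word_ne {n : ℕ} (π : SignedPerm n) {i j : ℕ} (hi : i < n) (hj : j < n) (h : i ≠ j) :
    -word π i ≠ word π j := by
  rw [word_of_lt π hi, word_of_lt π hj]
  exact neg_val_ne π (by simpa using h)

theorem entry_add_one {n : ℕ} (π : SignedPerm n) (i : ℕ) : entry π ((i : ℤ) + 1) = word π i := by
  have h1 : ((i : ℤ) + 1).natAbs = i + 1 := by omega
  have h2 : ((i : ℤ) + 1).sign = 1 := Int.sign_eq_one_of_pos (by omega)
  simp only [entry, word, h1, h2, val]
  by_cases h : i < n
  · simp [h]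
  · simp [h]

theorem entry_neg_one {n : ℕ} (π : SignedPerm n) : entry π (-1) = -word π 0 := by
  simp only [entry, word, val]
  by_cases h : 0 < n
  · simp [h, Nat.succ_le_iff]
  · simp [h, Nat.succ_le_iff]

/-- The contribution of a pair of entries to the type D inversion number. -/
def pairInv (x y : ℤ) : ℕ := (if x > y then 1 else 0) + (if -x > y then 1 else 0)

theorem pairInv_neg (x y : ℤ) : pairInv (-x) y = pairInv x y := by
  simp [pairInv, add_comm]

/-- The condition -x > y is symmetric in x and y, so only the first summand changes. -/
theorem pairInv_swap {x y : ℤ} (h : y < x) : pairInv x y = pairInv y x + 1 := by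
  unfold pairInv
  split_ifs <;> omega

theorem card_filter_pairs {n : ℕ} (P : ℤ → ℤ → Prop) [DecidableRel P] :
    ((Icc (1 : ℤ) n ×ˢ Icc (1 : ℤ) n).filter fun p => p.1 < p.2 ∧ P p.1 p.2).card =
      ∑ i : Fin n, ∑ j : Fin n, if i < j ∧ P ((i : ℕ) + 1) ((j : ℕ) + 1) then 1 else 0 := by
  rw [← Finset.sum_product' (s := univ) (t := univ)
    (f := fun i j : Fin n => if i < j ∧ P ((i : ℕ) + 1) ((j : ℕ) + 1) then 1 else 0),
    ← Finset.card_filter]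
  symm
  refine Finset.card_bij (fun p _ => (((p.1 : ℕ) : ℤ) + 1, ((p.2 : ℕ) : ℤ) + 1)) ?_ ?_ ?_
  · rintro ⟨i, j⟩ h
    simp only [mem_filter, mem_product, mem_univ, true_and, mem_Icc] at h ⊢
    have := i.2
    have := j.2
    have h1 : (i : ℕ) < j := h.1
    exact ⟨by omega, by omega, h.2⟩
  · rintro ⟨i, j⟩ - ⟨i', j'⟩ - h
    simp only [Prod.mk.injEq] at h
    ext <;> simp <;> omega
  · rintro ⟨i, j⟩ h
    simp only [mem_filter, mem_product, mem_Icc] at h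
    obtain ⟨a, rfl⟩ : ∃ a : ℕ, i = a + 1 := ⟨(i - 1).toNat, by omega⟩
    obtain ⟨b, rfl⟩ : ∃ b : ℕ, j = b + 1 := ⟨(j - 1).toNat, by omega⟩
    refine ⟨(⟨a, by omega⟩, ⟨b, by omega⟩), ?_, rfl⟩
    simp only [mem_filter, mem_product, mem_univ, true_and, Fin.mk_lt_mk]
    exact ⟨by omega, h.2.2⟩

theorem inv_eq_sum {n : ℕ} (π : SignedPerm n) :
    inv π = ∑ i : Fin n, ∑ j : Fin n, if i < j then pairInv (val π i) (val π j) else 0 := by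
  unfold inv
  rw [card_filter_pairs fun i j => entry π i > entry π j,
    card_filter_pairs fun i j => -entry π i > entry π j, ← sum_add_distrib]
  refine sum_congr rfl fun i _ => ?_
  rw [← sum_add_distrib]
  refine sum_congr rfl fun j _ => ?_
  simp only [entry_add_one, word_fin, pairInv]
  by_cases h : i < j <;> simp [h]

theorem prod_DES {K : Type*} [CommSemiring K] {n : ℕ} (hn : 2 ≤ n) (π : SignedPerm n) (s t : K) :
    s ^ edes π * t ^ odes π = (if -word π 0 > word π 1 then t else 1) *
      ∏ i ∈ range (n - 1), if word π i > word π (i + 1) then (if Even (i + 1) then s else t) else 1 := by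
  have h1 : s ^ edes π * t ^ odes π = ∏ i ∈ DES π, if Even i then s else t := by
    rw [Finset.prod_ite, prod_const, prod_const, edes, odes]
    simp [Int.not_even_iff_odd]
  -- The interval contains 0, which is not a descent position; it is split off and contributes a
  -- factor 1.
  have h2 : Icc (-1 : ℤ) ((n : ℤ) - 1) =
      insert (-1) (insert 0 ((range (n - 1)).image fun i : ℕ => (i : ℤ) + 1)) := by
    ext i
    simp only [mem_Icc, mem_insert, mem_image, mem_range]
    constructor
    · intro h
      by_cases h1 : i = -1
      · exact Or.inl h1
      by_cases h0 : i = 0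
      · exact Or.inr (Or.inl h0)
      exact Or.inr (Or.inr ⟨(i - 1).toNat, by omega, by omega⟩)
    · rintro (h | h | ⟨a, h, h'⟩) <;> omega
  rw [h1, DES, prod_filter, h2, prod_insert, prod_insert, prod_image]
  · congr 1
    · have := entry_add_one π 1
      norm_num at this
      simp [entry_neg_one, this]
    · simp only [ne_eq, not_true_eq_false, false_and, if_false, one_mul]
      refine prod_congr rfl fun i _ => ?_
      have h3 : |(i : ℤ) + 1| + 1 = ((i + 1 : ℕ) : ℤ) + 1 := by
        rw [abs_of_nonneg (by omega)]
        push_cast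
        ring
      have h4 : (i : ℤ) + 1 ≠ 0 := by omega
      have h5 : Even ((i : ℤ) + 1) ↔ Even (i + 1) := by exact_mod_cast Int.even_coe_nat (i + 1)
      rw [h3, entry_add_one, entry_add_one]
      simp only [h5, h4, not_false_eq_true, true_and]
  · intro i _ j _ h
    simpa using h
  · simp only [mem_image, mem_range, not_exists, not_and]
    intro i _
    omega
  · simp only [mem_insert, mem_image, mem_range, not_or, not_exists, not_and]
    refine ⟨by omega, fun i _ => by omega⟩

variable {K : Type*}

/-! ### Passing from `𝔇_n` to all signed permutations -/

/-- Change the sign of the entry of absolute value `1`. -/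
def toggleOne {n : ℕ} (π : SignedPerm (n + 1)) : SignedPerm (n + 1) :=
  (π.1, fun i => if π.1 i = 0 then -π.2 i else π.2 i)

theorem toggleOne_toggleOne {n : ℕ} (π : SignedPerm (n + 1)) : toggleOne (toggleOne π) = π := by
  refine Prod.ext rfl (funext fun i => ?_)
  simp only [toggleOne]
  split_ifs <;> simp

theorem mem_typeD_iff {n : ℕ} (π : SignedPerm n) : π ∈ typeD n ↔ ∏ i, π.2 i = 1 := by
  have h1 : ((Icc (1 : ℤ) n).filter fun i => entry π i < 0).card =
      (univ.filter fun i : Fin n => π.2 i = -1).card := by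
    symm
    refine Finset.card_bij (fun i _ => ((i : ℕ) : ℤ) + 1) ?_ ?_ ?_
    · intro i h
      simp only [mem_filter, mem_univ, true_and, mem_Icc] at h ⊢
      rw [entry_add_one, word_fin, val, h]
      have := i.2
      refine ⟨by omega, ?_⟩
      simp
      omega
    · intro i _ j _ h
      ext
      omega
    · intro i h
      simp only [mem_filter, mem_Icc] at h
      obtain ⟨a, rfl⟩ : ∃ a : ℕ, i = a + 1 := ⟨(i - 1).toNat, by omega⟩
      refine ⟨⟨a, by omega⟩, ?_, rfl⟩
      have h2 := h.2
      rw [entry_add_one, word_of_lt π (by omega), val] at h2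
      simp only [mem_filter, mem_univ, true_and]
      rcases Int.units_eq_one_or (π.2 ⟨a, by omega⟩) with h3 | h3
      · rw [h3] at h2
        simp at h2
        omega
      · exact h3
  have h2 : ∏ i, π.2 i = (-1) ^ (univ.filter fun i : Fin n => π.2 i = -1).card := by
    rw [← prod_const, prod_filter]
    refine prod_congr rfl fun i _ => ?_
    rcases Int.units_eq_one_or (π.2 i) with h | h <;> simp [h]
  rw [typeD, mem_filter, h1, h2]
  simp only [mem_univ, true_and]
  rcases Nat.even_or_odd (univ.filter fun i : Fin n => π.2 i = -1).card with h | h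
  · simp [h]
  · simp [h.neg_one_pow, Nat.not_even_iff_odd.2 h]

theorem toggleOne_mem_typeD {n : ℕ} (π : SignedPerm (n + 1)) :
    toggleOne π ∈ typeD (n + 1) ↔ π ∉ typeD (n + 1) := by
  have h : ∏ i, (toggleOne π).2 i = -∏ i, π.2 i := by
    have h0 : ∏ i, (toggleOne π).2 i = ∏ i, (if i = π.1.symm 0 then (-1) else 1) * π.2 i := by
      refine prod_congr rfl fun i _ => ?_
      simp only [toggleOne, Equiv.eq_symm_apply]
      split_ifs <;> simp
    rw [h0, prod_mul_distrib, prod_ite_eq' univ]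
    simp
  rw [mem_typeD_iff, mem_typeD_iff, h]
  rcases Int.units_eq_one_or (∏ i, π.2 i) with h | h <;> simp [h]

/-- `toggleOne` is an involution exchanging `typeD (n + 1)` with its complement, so both halves have
equal sums. -/
theorem sum_typeD [CommSemiring K] {n : ℕ} (f : SignedPerm (n + 1) → K)
    (hf : ∀ π, f (toggleOne π) = f π) : ∑ π, f π = 2 * ∑ π ∈ typeD (n + 1), f π := by
  rw [← sum_filter_add_sum_filter_not univ (· ∈ typeD (n + 1)), two_mul]
  congr 1
  · simp
  · refine sum_nbij' toggleOne toggleOne ?_ ?_ ?_ ?_ ?_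
    · intro π h
      simpa [toggleOne_mem_typeD] using h
    · intro π h
      simp [toggleOne_mem_typeD, h]
    · intro π _
      exact toggleOne_toggleOne π
    · intro π _
      exact toggleOne_toggleOne π
    · intro π _
      exact (hf π).symm

/-- Of two entries at different positions at most one is ±1, and the other then has absolute value
at least 2, so it alone decides both comparisons. -/
theorem val_toggleOne_lt {n : ℕ} (π : SignedPerm (n + 1)) {i j : Fin (n + 1)} (h : i ≠ j) :
    (val (toggleOne π) j < val (toggleOne π) i ↔ val π j < val π i) ∧
    (val (toggleOne π) j < -val (toggleOne π) i ↔ val π j < -val π i) := by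
  have hne : ((π.1 i : Fin (n + 1)) : ℕ) ≠ (π.1 j : Fin (n + 1)) :=
    fun e => h (π.1.injective (Fin.ext e))
  simp only [val, toggleOne, Fin.ext_iff, Fin.val_zero]
  rcases Int.units_eq_one_or (π.2 i) with hi | hi <;>
    rcases Int.units_eq_one_or (π.2 j) with hj | hj <;>
    simp only [hi, hj] <;> split_ifs <;>
    simp only [Units.val_neg, Units.val_one, and_self] <;> omega

theorem inv_toggleOne {n : ℕ} (π : SignedPerm (n + 1)) : inv (toggleOne π) = inv π := by
  rw [inv_eq_sum, inv_eq_sum]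
  refine sum_congr rfl fun i _ => sum_congr rfl fun j _ => ?_
  by_cases h : i < j
  · simp only [pairInv, gt_iff_lt, (val_toggleOne_lt π h.ne).1, (val_toggleOne_lt π h.ne).2]
  · simp [h]

/-! ### Adjacent transpositions and the sign of the first entry -/

/-- Rearrange the entries of a signed permutation. -/
def permute {n : ℕ} (τ : Equiv.Perm (Fin n)) (π : SignedPerm n) : SignedPerm n :=
  (τ.trans π.1, fun i => π.2 (τ i))

theorem val_permute {n : ℕ} (τ : Equiv.Perm (Fin n)) (π : SignedPerm n) (i : Fin n) :
    val (permute τ π) i = val π (τ i) := rfl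

theorem permute_swap_permute_swap {n : ℕ} (a b : Fin n) (π : SignedPerm n) :
    permute (Equiv.swap a b) (permute (Equiv.swap a b) π) = π := by
  refine Prod.ext (Equiv.ext fun i => ?_) (funext fun i => ?_) <;> simp [permute]

theorem swap_lt_swap {n : ℕ} {a b : Fin n} (hab : (b : ℕ) = a + 1) (i j : Fin n) :
    (Equiv.swap a b i < Equiv.swap a b j) ↔ ((i < j ∧ ¬(i = a ∧ j = b)) ∨ (i = b ∧ j = a)) := by
  simp only [Equiv.swap_apply_def, Fin.ext_iff, Fin.lt_def]
  split_ifs <;> omega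

theorem inv_permute_swap {n : ℕ} {a b : Fin n} (hab : (b : ℕ) = a + 1) (π : SignedPerm n)
    (h : val π b < val π a) : inv π = inv (permute (Equiv.swap a b) π) + 1 := by
  set g : Fin n → Fin n → ℕ := fun i j => pairInv (val π i) (val π j) with hg
  have h1 : inv (permute (Equiv.swap a b) π) =
      ∑ i, ∑ j, if Equiv.swap a b i < Equiv.swap a b j then g i j else 0 := by
    rw [inv_eq_sum, ← Equiv.sum_comp (Equiv.swap a b)]
    refine sum_congr rfl fun i _ => ?_
    rw [← Equiv.sum_comp (Equiv.swap a b)]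
    refine sum_congr rfl fun j _ => ?_
    simp [val_permute, hg]
  -- Only the pair {a, b} is counted in a different order. Its two possible terms are added on
  -- opposite sides to avoid subtraction in ℕ.
  have h2 : inv (permute (Equiv.swap a b) π) + ∑ i, ∑ j, (if i = a ∧ j = b then g i j else 0) =
      inv π + ∑ i, ∑ j, (if i = b ∧ j = a then g i j else 0) := by
    rw [h1, inv_eq_sum, ← sum_add_distrib, ← sum_add_distrib]
    refine sum_congr rfl fun i _ => ?_
    rw [← sum_add_distrib, ← sum_add_distrib]
    refine sum_congr rfl fun j _ => ?_
    simp only [swap_lt_swap hab]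
    have hlt : a < b := by
      rw [Fin.lt_def]
      omega
    by_cases h3 : i = a ∧ j = b
    · obtain ⟨rfl, rfl⟩ := h3
      simp [hlt, hlt.ne, hlt.ne', hg]
    · by_cases h4 : i = b ∧ j = a
      · obtain ⟨rfl, rfl⟩ := h4
        simp [hlt.ne, hlt.ne', hlt.le.not_gt, hg]
      · simp [h3, h4, hg]
  have h3 : ∀ c d : Fin n, ∑ i, ∑ j, (if i = c ∧ j = d then g i j else 0) = g c d := by
    intro c d
    simp [ite_and]
  rw [h3, h3] at h2
  have h4 : g a b = g b a + 1 := pairInv_swap h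
  omega

/-- Change the sign of the first entry. -/
def flipFirst {n : ℕ} (π : SignedPerm (n + 1)) : SignedPerm (n + 1) :=
  (π.1, fun i => if i = 0 then -π.2 i else π.2 i)

theorem flipFirst_flipFirst {n : ℕ} (π : SignedPerm (n + 1)) : flipFirst (flipFirst π) = π := by
  refine Prod.ext rfl (funext fun i => ?_)
  simp only [flipFirst]
  split_ifs <;> simp

theorem val_flipFirst {n : ℕ} (π : SignedPerm (n + 1)) (i : Fin (n + 1)) :
    val (flipFirst π) i = if i = 0 then -val π i else val π i := by
  simp only [flipFirst, val]
  split_ifs <;> simp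

/-- The first entry occurs only as the left member of a pair, and `pairInv` is even in that
argument. -/
theorem inv_flipFirst {n : ℕ} (π : SignedPerm (n + 1)) : inv (flipFirst π) = inv π := by
  rw [inv_eq_sum, inv_eq_sum]
  refine sum_congr rfl fun i _ => sum_congr rfl fun j _ => ?_
  by_cases h : i < j
  · have hj : j ≠ 0 := (Fin.pos_of_ne_zero (by rintro rfl; simp at h)).ne'
    rw [if_pos h, if_pos h, val_flipFirst, val_flipFirst, if_neg hj]
    split_ifs
    · rw [pairInv_neg]
    · rfl
  · simp [h]

/-! ### Appending a last entry -/

/-- Append a last entry with absolute value `v + 1` and sign `ε`, moving up the entries whose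
absolute values are at least `v + 1`. -/
def append {n : ℕ} (v : Fin (n + 1)) (ε : ℤˣ) (σ : SignedPerm n) : SignedPerm (n + 1) :=
  (finSuccEquivLast.trans ((Equiv.optionCongr σ.1).trans (finSuccEquiv' v).symm),
    Fin.snoc (α := fun _ => ℤˣ) σ.2 ε)

theorem append_fst_last {n : ℕ} (v : Fin (n + 1)) (ε : ℤˣ) (σ : SignedPerm n) :
    (append v ε σ).1 (Fin.last n) = v := by
  simp [append]

theorem append_fst_castSucc {n : ℕ} (v : Fin (n + 1)) (ε : ℤˣ) (σ : SignedPerm n) (i : Fin n) :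
    (append v ε σ).1 i.castSucc = v.succAbove (σ.1 i) := by
  simp [append]

theorem append_snd_last {n : ℕ} (v : Fin (n + 1)) (ε : ℤˣ) (σ : SignedPerm n) :
    (append v ε σ).2 (Fin.last n) = ε := by
  simp [append]

theorem append_snd_castSucc {n : ℕ} (v : Fin (n + 1)) (ε : ℤˣ) (σ : SignedPerm n) (i : Fin n) :
    (append v ε σ).2 i.castSucc = σ.2 i := by
  simp [append]

theorem append_bijective (n : ℕ) : Function.Bijective
    fun p : (Fin (n + 1) × ℤˣ) × SignedPerm n => append p.1.1 p.1.2 p.2 := by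
  rw [Fintype.bijective_iff_injective_and_card]
  constructor
  · rintro ⟨⟨v, ε⟩, σ⟩ ⟨⟨v', ε'⟩, σ'⟩ h
    simp only at h
    have hv : v = v' := by rw [← append_fst_last v ε σ, h, append_fst_last]
    have hε : ε = ε' := by rw [← append_snd_last v ε σ, h, append_snd_last]
    subst hv hε
    refine Prod.ext rfl (Prod.ext (Equiv.ext fun i => ?_) (funext fun i => ?_))
    · have := append_fst_castSucc v ε σ i
      rw [h, append_fst_castSucc] at this
      exact (Fin.succAbove_right_injective this).symm
    · rw [← append_snd_castSucc v ε σ i, h, append_snd_castSucc]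
  · simp [Fintype.card_perm, Nat.factorial_succ, pow_succ]
    ring

/-- Absolute values are relabelled by the increasing map `v.succAbove` and signs are kept, so
relative order survives, also after negating one entry. -/
theorem val_append_lt {n : ℕ} (v : Fin (n + 1)) (ε : ℤˣ) (σ : SignedPerm n) (i j : Fin n) :
    (val (append v ε σ) j.castSucc < val (append v ε σ) i.castSucc ↔ val σ j < val σ i) ∧
    (val (append v ε σ) j.castSucc < -val (append v ε σ) i.castSucc ↔ val σ j < -val σ i) := by
  simp only [val, append_fst_castSucc, append_snd_castSucc]
  rcases Int.units_eq_one_or (σ.2 i) with hi | hi <;>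
    rcases Int.units_eq_one_or (σ.2 j) with hj | hj <;>
    simp only [hi, hj, Fin.succAbove, Fin.lt_def, Fin.val_castSucc] <;> split_ifs <;>
    simp <;> omega

theorem pairInv_abs (x y : ℤ) : pairInv |x| y = pairInv x y := by
  rcases abs_choice x with h | h <;> rw [h]
  exact pairInv_neg x y

/-- By `pairInv_abs`, pairs ending in the new entry depend only on the absolute values of the
earlier entries, and these run through everything except v. -/
theorem inv_append_aux {n : ℕ} (v : Fin (n + 1)) (ε : ℤˣ) (σ : SignedPerm n) :
    inv (append v ε σ) = inv σ +
      ∑ w : Fin n, pairInv ((v.succAbove w : ℕ) + 1) ((ε : ℤ) * (v + 1)) := by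
  rw [inv_eq_sum, inv_eq_sum, Fin.sum_univ_castSucc]
  have h0 : ∑ j, (if Fin.last n < j then
      pairInv (val (append v ε σ) (Fin.last n)) (val (append v ε σ) j) else 0) = 0 :=
    sum_eq_zero fun j _ => by simp [Fin.le_last]
  rw [h0, add_zero, ← Equiv.sum_comp σ.1
    fun w => pairInv ((v.succAbove w : ℕ) + 1) ((ε : ℤ) * (v + 1)), ← sum_add_distrib]
  refine sum_congr rfl fun i _ => ?_
  rw [Fin.sum_univ_castSucc]
  congr 1
  · refine sum_congr rfl fun j _ => ?_
    simp only [pairInv, gt_iff_lt, (val_append_lt v ε σ i j).1, (val_append_lt v ε σ i j).2,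
      Fin.castSucc_lt_castSucc_iff]
  · rw [if_pos (Fin.castSucc_lt_last i), ← pairInv_abs, abs_val, append_fst_castSucc]
    simp [val, append_fst_last, append_snd_last]

theorem card_lt_succAbove {n : ℕ} (v : Fin (n + 1)) :
    ∑ w : Fin n, (if (v : ℕ) < (v.succAbove w : ℕ) then 1 else 0) = n - v := by
  have h : (univ.filter fun w : Fin n => (v : ℕ) < (v.succAbove w : ℕ)) =
      (univ.filter fun w : Fin n => ¬ (w : ℕ) < v) := by
    ext w
    simp only [mem_filter, mem_univ, true_and, Fin.succAbove, Fin.lt_def, Fin.val_castSucc]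
    split_ifs <;> simp only [Fin.val_castSucc, Fin.val_succ] <;> omega
  rw [← card_filter, h, filter_not, card_sdiff_of_subset (filter_subset _ _)]
  have := Fin.card_filter_val_lt (n := n) (m := v)
  simp [this]
  omega

theorem inv_append_one {n : ℕ} (v : Fin (n + 1)) (σ : SignedPerm n) :
    inv (append v 1 σ) = inv σ + (n - v) := by
  rw [inv_append_aux, ← card_lt_succAbove]
  congr 1
  refine sum_congr rfl fun w _ => ?_
  unfold pairInv
  simp only [Units.val_one, one_mul]
  split_ifs <;> omega

theorem inv_append_neg_one {n : ℕ} (v : Fin (n + 1)) (σ : SignedPerm n) :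
    inv (append v (-1) σ) = inv σ + (n + v) := by
  -- Against -(v + 1), each earlier absolute value counts once always and once more if it is below v
  -- + 1; adding the indicator of the larger ones makes every term 2.
  have h : ∑ w : Fin n, (pairInv ((v.succAbove w : ℕ) + 1) (((-1 : ℤˣ) : ℤ) * (v + 1)) +
      (if (v : ℕ) < (v.succAbove w : ℕ) then 1 else 0)) = ∑ w : Fin n, 2 := by
    refine sum_congr rfl fun w _ => ?_
    have : (v.succAbove w : ℕ) ≠ v := fun e => Fin.succAbove_ne v w (Fin.ext e)
    unfold pairInv
    simp only [Units.val_neg, Units.val_one, neg_mul, one_mul]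
    split_ifs <;> omega
  rw [sum_add_distrib, card_lt_succAbove] at h
  simp only [sum_const, card_univ, Fintype.card_fin, smul_eq_mul] at h
  rw [inv_append_aux]
  have := v.2
  omega

/-- Summing over the last entry gives ∑ q^(n - v) + ∑ q^(n + v), which is [n+1]_q (1 + q^n). -/
theorem sum_append [CommSemiring K] {n : ℕ} (q : K) (f : SignedPerm (n + 1) → K)
    (g : SignedPerm n → K) (h : ∀ v ε σ, f (append v ε σ) = g σ) :
    ∑ π, f π * q ^ inv π = qNumber q (n + 1) * (1 + q ^ n) * ∑ σ, g σ * q ^ inv σ := by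
  rw [← (append_bijective n).sum_comp fun π => f π * q ^ inv π, Fintype.sum_prod_type, mul_sum,
    sum_comm]
  refine sum_congr rfl fun σ _ => ?_
  rw [Fintype.sum_prod_type]
  have hu : ∀ F : ℤˣ → K, ∑ ε, F ε = F 1 + F (-1) := fun F => by
    rw [show (univ : Finset ℤˣ) = {1, -1} from rfl, sum_insert (by decide), sum_singleton]
  simp only [hu, h, inv_append_one, inv_append_neg_one, pow_add, sum_add_distrib]
  have h1 : ∑ v : Fin (n + 1), q ^ (n - (v : ℕ)) = qNumber q (n + 1) := by
    rw [Fin.sum_univ_eq_sum_range (fun i => q ^ (n - i)), qNumber, ← sum_range_reflect]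
    refine sum_congr rfl fun i hi => ?_
    have := mem_range.1 hi
    congr 1
    omega
  have h2 : ∑ v : Fin (n + 1), q ^ (v : ℕ) = qNumber q (n + 1) := by
    rw [Fin.sum_univ_eq_sum_range (fun i => q ^ i), qNumber]
  simp only [← mul_sum, h1, h2]
  ring

/-! ### Sorting the last entries -/

/-- The entries in the positions `l, …, n - 1` (counted from `0`) increase. -/
def Asc {n : ℕ} (l : ℕ) (π : SignedPerm n) : Prop :=
  ∀ i j, l ≤ i → i < j → j < n → word π i < word π j

/-- The entries in the positions `l, …, n - 1` other than `p` increase, and those before `p` are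
smaller than the entry in position `p`. -/
def AscBut {n : ℕ} (l p : ℕ) (π : SignedPerm n) : Prop :=
  (∀ i j, l ≤ i → i < j → j < n → i ≠ p → j ≠ p → word π i < word π j) ∧
    ∀ i, l ≤ i → i < p → word π i < word π p

/-- Exchange the entries in the positions `p` and `p + 1`. -/
def swapAt {n : ℕ} (p : ℕ) (hp : p + 1 < n) (π : SignedPerm n) : SignedPerm n :=
  permute (Equiv.swap ⟨p, by omega⟩ ⟨p + 1, hp⟩) π

theorem swapAt_swapAt {n : ℕ} (p : ℕ) (hp : p + 1 < n) (π : SignedPerm n) :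
    swapAt p hp (swapAt p hp π) = π :=
  permute_swap_permute_swap _ _ π

theorem word_swapAt {n : ℕ} (p : ℕ) (hp : p + 1 < n) (π : SignedPerm n) (i : ℕ) :
    word (swapAt p hp π) i = word π (if i = p then p + 1 else if i = p + 1 then p else i) := by
  by_cases hi : i < n
  · rw [word_of_lt _ hi, swapAt, val_permute, ← word_fin]
    congr 1
    rw [Equiv.swap_apply_def]
    simp only [Fin.ext_iff]
    split_ifs <;> rfl
  · rw [if_neg (by omega), if_neg (by omega)]
    simp [word, hi]

theorem word_swapAt_left {n : ℕ} (p : ℕ) (hp : p + 1 < n) (π : SignedPerm n) :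
    word (swapAt p hp π) p = word π (p + 1) := by
  simp [word_swapAt]

theorem word_swapAt_right {n : ℕ} (p : ℕ) (hp : p + 1 < n) (π : SignedPerm n) :
    word (swapAt p hp π) (p + 1) = word π p := by
  simp [word_swapAt]

theorem word_swapAt_of_ne {n : ℕ} {p : ℕ} (hp : p + 1 < n) (π : SignedPerm n) {i : ℕ}
    (h : i ≠ p) (h' : i ≠ p + 1) : word (swapAt p hp π) i = word π i := by
  simp [word_swapAt, h, h']

theorem inv_swapAt {n : ℕ} {p : ℕ} (hp : p + 1 < n) (π : SignedPerm n)
    (h : word π (p + 1) < word π p) : inv π = inv (swapAt p hp π) + 1 := by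
  refine inv_permute_swap rfl π ?_
  rwa [word_of_lt π hp, word_of_lt π (by omega : p < n)] at h

theorem asc_iff_ascBut {n l p : ℕ} (hl : l ≤ p) (hp : p + 1 < n) (π : SignedPerm n) :
    Asc l π ↔ AscBut l p π ∧ word π p < word π (p + 1) := by
  constructor
  · intro h
    exact ⟨⟨fun i j h1 h2 h3 _ _ => h i j h1 h2 h3, fun i h1 h2 => h i p h1 h2 (by omega)⟩,
      h p (p + 1) hl (by omega) hp⟩
  · rintro ⟨⟨h1, h2⟩, h3⟩ i j hi hij hj
    by_cases e : i = p
    · subst e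
      rcases (show i + 1 ≤ j by omega).eq_or_lt with e' | e'
      · rwa [← e']
      · exact h3.trans (h1 (i + 1) j (by omega) e' hj (by omega) (by omega))
    · by_cases e' : j = p
      · subst e'
        exact h2 i hi hij
      · exact h1 i j hi hij hj e e'

theorem asc_iff_ascBut_last {n l : ℕ} (π : SignedPerm (n + 1)) :
    Asc l π ↔ AscBut l n π := by
  constructor
  · intro h
    exact ⟨fun i j h1 h2 h3 _ _ => h i j h1 h2 h3, fun i h1 h2 => h i n h1 h2 (by omega)⟩
  · rintro ⟨h1, h2⟩ i j hi hij hj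
    by_cases e' : j = n
    · subst e'
      exact h2 i hi hij
    · exact h1 i j hi hij hj (by omega) e'

theorem ascBut_self {n l : ℕ} (π : SignedPerm n) : AscBut l l π ↔ Asc (l + 1) π := by
  constructor
  · intro h i j hi hij hj
    exact h.1 i j (by omega) hij hj (by omega) (by omega)
  · intro h
    exact ⟨fun i j h1 h2 h3 h4 h5 => h i j (by omega) h2 h3, fun i h1 h2 => by omega⟩

/-- `AscBut l p` is a state of insertion sort: a descent at p means that the marked entry p + 1 of
the swapped word moved one step left. The extremes are `Asc (l + 1)` at p = l and `Asc l` at the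
last position. -/
theorem ascBut_swapAt {n l p : ℕ} (hl : l ≤ p) (hp : p + 1 < n) (π : SignedPerm n) :
    AscBut l (p + 1) (swapAt p hp π) ↔ AscBut l p π ∧ word π (p + 1) < word π p := by
  constructor
  · rintro ⟨h1, h2⟩
    have h0 := h2 p hl (by omega)
    rw [word_swapAt_left, word_swapAt_right] at h0
    refine ⟨⟨fun i j hi hij hj e e' => ?_, fun i hi hip => ?_⟩, h0⟩
    · by_cases e1 : i = p + 1
      · have := h1 p j hl (by omega) hj (by omega) (by omega)
        rwa [word_swapAt_left, word_swapAt_of_ne hp π (by omega) (by omega), ← e1] at this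
      · by_cases e2 : j = p + 1
        · have := h1 i p hi (by omega) (by omega) (by omega) (by omega)
          rwa [word_swapAt_left, word_swapAt_of_ne hp π (by omega) (by omega), ← e2] at this
        · have := h1 i j hi hij hj e1 e2
          rwa [word_swapAt_of_ne hp π (by omega) (by omega),
            word_swapAt_of_ne hp π (by omega) (by omega)] at this
    · have := h2 i hi (by omega)
      rwa [word_swapAt_right, word_swapAt_of_ne hp π (by omega) (by omega)] at this
  · rintro ⟨⟨h1, h2⟩, h3⟩
    refine ⟨fun i j hi hij hj e e' => ?_, fun i hi hip => ?_⟩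
    · by_cases e1 : i = p
      · subst e1
        rw [word_swapAt_left, word_swapAt_of_ne hp π (by omega) (by omega)]
        exact h1 _ _ (by omega) (by omega) hj (by omega) (by omega)
      · by_cases e2 : j = p
        · subst e2
          rw [word_swapAt_left, word_swapAt_of_ne hp π (by omega) (by omega)]
          exact h1 _ _ (by omega) (by omega) hp (by omega) (by omega)
        · rw [word_swapAt_of_ne hp π (by omega) (by omega),
            word_swapAt_of_ne hp π (by omega) (by omega)]
          exact h1 _ _ (by omega) (by omega) hj (by omega) (by omega)
    · rw [word_swapAt_right]
      by_cases e1 : i = p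
      · subst e1
        rwa [word_swapAt_left]
      · rw [word_swapAt_of_ne hp π (by omega) (by omega)]
        exact h2 i hi (by omega)

open scoped Classical in
-- If the marked entry is below its right neighbour, the tail is sorted; otherwise exchanging the
-- two moves the mark right and removes exactly one inversion.
theorem sum_ascBut_succ [CommSemiring K] {n l p : ℕ} (hl : l ≤ p) (hp : p + 1 < n) (q : K)
    (g : SignedPerm n → K) (hg : ∀ π, g (swapAt p hp π) = g π) :
    ∑ π with AscBut l p π, g π * q ^ inv π =
      ∑ π with Asc l π, g π * q ^ inv π + q * ∑ π with AscBut l (p + 1) π, g π * q ^ inv π := by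
  rw [← sum_filter_add_sum_filter_not (univ.filter fun π => AscBut l p π)
    fun π => word π p < word π (p + 1)]
  have hlt : ∀ π : SignedPerm n, ¬ word π p < word π (p + 1) ↔ word π (p + 1) < word π p :=
    fun π => ⟨fun h => lt_of_le_of_ne (not_lt.1 h)
      (word_ne π hp (by omega) (by omega)), fun h => h.not_gt⟩
  congr 1
  · rw [filter_filter]
    simp only [asc_iff_ascBut hl hp]
  · rw [filter_filter, mul_sum]
    simp only [hlt, ← ascBut_swapAt hl hp]
    refine sum_nbij' (swapAt p hp) (swapAt p hp) ?_ ?_ ?_ ?_ ?_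
    · intro π h
      simpa using h
    · intro π h
      simpa [swapAt_swapAt] using h
    · intro π _
      exact swapAt_swapAt p hp π
    · intro π _
      exact swapAt_swapAt p hp π
    · intro π h
      simp only [mem_filter, mem_univ, true_and] at h
      rw [hg, inv_swapAt hp π ((ascBut_swapAt hl hp π).1 h).2]
      ring

theorem qNumber_succ [CommSemiring K] (q : K) (n : ℕ) :
    qNumber q (n + 1) = 1 + q * qNumber q n := by
  rw [qNumber, sum_range_succ', qNumber, mul_sum, add_comm]
  simp [pow_succ, mul_comm]

open scoped Classical in
theorem sum_ascBut [CommSemiring K] {n l : ℕ} (q : K) (g : SignedPerm (n + 1) → K)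
    (hg : ∀ p hp π, l ≤ p → g (swapAt p hp π) = g π) (d : ℕ) (hd : l + d ≤ n) :
    ∑ π with AscBut l (n - d) π, g π * q ^ inv π =
      qNumber q (d + 1) * ∑ π with Asc l π, g π * q ^ inv π := by
  induction d with
  | zero =>
    simp only [Nat.sub_zero, ← asc_iff_ascBut_last]
    simp [qNumber]
  | succ d ih =>
    rw [sum_ascBut_succ (by omega) (by omega : n - (d + 1) + 1 < n + 1) q g
      (fun π => hg _ _ _ (by omega)), show n - (d + 1) + 1 = n - d by omega, ih (by omega),
      qNumber_succ q (d + 1)]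
    ring

open scoped Classical in
theorem sum_asc_succ [CommSemiring K] {n l : ℕ} (hl : l < n) (q : K) (g : SignedPerm n → K)
    (hg : ∀ p hp π, l ≤ p → g (swapAt p hp π) = g π) :
    ∑ π with Asc (l + 1) π, g π * q ^ inv π =
      qNumber q (n - l) * ∑ π with Asc l π, g π * q ^ inv π := by
  obtain ⟨m, rfl⟩ : ∃ m, n = m + 1 := ⟨n - 1, by omega⟩
  have := sum_ascBut q g hg (m - l) (by omega)
  simp only [show m - (m - l) = l by omega, ascBut_self] at this
  rw [this, show m - l + 1 = m + 1 - l by omega]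

theorem qFactorial_succ [CommSemiring K] (q : K) (n : ℕ) :
    qFactorial q (n + 1) = qFactorial q n * qNumber q (n + 1) := by
  rw [qFactorial, prod_Icc_succ_top (by omega), qFactorial]

open scoped Classical in
-- Inserting the entries of the tail one at a time contributes [1]_q, [2]_q, …, [n-l]_q.
theorem sum_asc [CommSemiring K] {n l : ℕ} (hl : l ≤ n) (q : K) (g : SignedPerm n → K)
    (hg : ∀ p hp π, l ≤ p → g (swapAt p hp π) = g π) :
    qFactorial q (n - l) * ∑ π with Asc l π, g π * q ^ inv π = ∑ π, g π * q ^ inv π := by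
  obtain ⟨d, rfl⟩ : ∃ d, n = l + d := ⟨n - l, by omega⟩
  clear hl
  induction d generalizing l with
  | zero =>
    have : ∀ π : SignedPerm (l + 0), Asc l π := fun π i j h1 h2 h3 => by omega
    simp [this, qFactorial]
  | succ d ih =>
    have h := sum_asc_succ (n := l + (d + 1)) (by omega) q g hg
    have e : l + (d + 1) = l + 1 + d := by omega
    have ih' : qFactorial q d * ∑ π : SignedPerm (l + (d + 1)) with Asc (l + 1) π, g π * q ^ inv π =
        ∑ π, g π * q ^ inv π := by
      clear h
      -- The length occurs in the type of π, so it is made a variable before rewriting it as l + 1 +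
      -- d.
      generalize l + (d + 1) = n at *
      subst e
      have := ih g (fun p hp π h => hg p hp π (by omega))
      rwa [show l + 1 + d - (l + 1) = d by omega] at this
    rw [← ih', h, show l + (d + 1) - l = d + 1 by omega, qFactorial_succ, mul_assoc]

/-! ### The weight of a descent set -/

/-- The product of the weights of the descents at `-1, 1, …, k - 1`, where descents at `-1` have
weight `t` and those at `i > 0` have weight `x i`. -/
def weight [CommSemiring K] (x : ℕ → K) (t : K) {n : ℕ} (k : ℕ) (π : SignedPerm n) : K :=
  (if -word π 0 > word π 1 then t else 1) *
    ∏ i ∈ range (k - 1), if word π i > word π (i + 1) then x (i + 1) else 1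

theorem weight_swapAt [CommSemiring K] (x : ℕ → K) (t : K) {n k : ℕ} (hk : 2 ≤ k) (p : ℕ)
    (hp : p + 1 < n) (π : SignedPerm n) (h : k ≤ p) :
    weight x t k (swapAt p hp π) = weight x t k π := by
  unfold weight
  rw [word_swapAt_of_ne hp π (by omega) (by omega), word_swapAt_of_ne hp π (by omega) (by omega)]
  congr 1
  refine prod_congr rfl fun i hi => ?_
  have := mem_range.1 hi
  rw [word_swapAt_of_ne hp π (by omega) (by omega), word_swapAt_of_ne hp π (by omega) (by omega)]

theorem word_append_lt {n : ℕ} (v : Fin (n + 1)) (ε : ℤˣ) (σ : SignedPerm n) {i j : ℕ}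
    (hi : i < n) (hj : j < n) :
    (word (append v ε σ) j < word (append v ε σ) i ↔ word σ j < word σ i) ∧
    (word (append v ε σ) j < -word (append v ε σ) i ↔ word σ j < -word σ i) := by
  have := val_append_lt v ε σ ⟨i, hi⟩ ⟨j, hj⟩
  rwa [word_of_lt _ (by omega), word_of_lt _ (by omega), word_of_lt σ hi, word_of_lt σ hj]

theorem weight_append [CommSemiring K] (x : ℕ → K) (t : K) {n k : ℕ} (hk : 2 ≤ k) (hkn : k ≤ n)
    (v : Fin (n + 1)) (ε : ℤˣ) (σ : SignedPerm n) :
    weight x t k (append v ε σ) = weight x t k σ := by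
  unfold weight
  simp only [gt_iff_lt, (word_append_lt v ε σ (show 0 < n by omega) (show 1 < n by omega)).2]
  congr 1
  refine prod_congr rfl fun i hi => ?_
  have := mem_range.1 hi
  simp only [(word_append_lt v ε σ (show i < n by omega) (show i + 1 < n by omega)).1]

theorem sum_inv [CommSemiring K] (q : K) (n : ℕ) :
    ∑ π : SignedPerm n, q ^ inv π = ∏ i ∈ range n, (qNumber q (i + 1) * (1 + q ^ i)) := by
  induction n with
  | zero =>
    rw [Fintype.sum_subsingleton _ ((1, 1) : SignedPerm 0)]
    simp [inv]
  | succ n ih =>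
    have := sum_append (n := n) q (fun _ => 1) (fun _ => 1) (fun _ _ _ => rfl)
    simp only [one_mul] at this
    rw [this, ih, prod_range_succ, mul_comm]

/-- Appending an entry leaves the weight of the first k entries unchanged and multiplies both sums
over length n by the same factor. The identity of ratios is cross-multiplied. -/
theorem sum_weight [CommSemiring K] (x : ℕ → K) (t q : K) {n k : ℕ} (hk : 2 ≤ k) (hkn : k ≤ n) :
    (∑ π : SignedPerm k, q ^ inv π) * ∑ π : SignedPerm n, weight x t k π * q ^ inv π =
      (∑ π : SignedPerm n, q ^ inv π) * ∑ π : SignedPerm k, weight x t k π * q ^ inv π := by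
  induction n, hkn using Nat.le_induction with
  | base => rfl
  | succ n hn ih =>
    rw [sum_append q _ _ (weight_append x t hk hn), sum_inv q (n + 1), prod_range_succ, ← sum_inv,
      mul_left_comm, ih]
    ring

/-! ### The recurrence -/

theorem asc_iff_asc_succ {n l : ℕ} (hl : l + 1 < n) (π : SignedPerm n) :
    Asc l π ↔ Asc (l + 1) π ∧ word π l < word π (l + 1) := by
  rw [asc_iff_ascBut le_rfl hl, ascBut_self]

theorem weight_succ [CommSemiring K] (x : ℕ → K) (t : K) {n m : ℕ} (π : SignedPerm n) :
    weight x t (m + 2) π =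
      weight x t (m + 1) π * if word π m > word π (m + 1) then x (m + 1) else 1 := by
  rw [weight, weight, show m + 2 - 1 = m + 1 by omega, prod_range_succ, mul_assoc]
  rfl

open scoped Classical in
-- This is x^[descent] = x + (1 - x)[ascent] for the new position: an ascent there extends the
-- increasing tail to the left by one entry.
theorem sum_asc_weight_succ [CommRing K] (x : ℕ → K) (t q : K) {n m : ℕ} (hm : m + 1 < n) :
    ∑ π : SignedPerm n with Asc (m + 1) π, weight x t (m + 2) π * q ^ inv π =
      x (m + 1) * ∑ π : SignedPerm n with Asc (m + 1) π, weight x t (m + 1) π * q ^ inv π +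
      (1 - x (m + 1)) * ∑ π : SignedPerm n with Asc m π, weight x t (m + 1) π * q ^ inv π := by
  simp only [asc_iff_asc_succ hm]
  rw [← filter_filter, sum_filter (s := filter _ _), mul_sum, mul_sum, ← sum_add_distrib]
  refine sum_congr rfl fun π _ => ?_
  rw [weight_succ]
  rcases lt_or_gt_of_ne (word_ne π (show m < n by omega) hm (by omega)) with h | h
  · simp only [h, h.not_gt, if_true, if_false]
    ring
  · simp only [h, h.not_gt, if_true, if_false]
    ring

open scoped Classical in
theorem sum_asc_weight_one [CommRing K] (x : ℕ → K) (t q : K) {n l : ℕ} (hn : 1 < n) :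
    ∑ π : SignedPerm n with Asc l π, weight x t 1 π * q ^ inv π =
      t * ∑ π : SignedPerm n with Asc l π, q ^ inv π +
      (1 - t) * ∑ π : SignedPerm n with Asc l π ∧ -word π 0 < word π 1, q ^ inv π := by
  rw [← filter_filter, sum_filter (s := filter _ _), mul_sum, mul_sum, ← sum_add_distrib]
  refine sum_congr rfl fun π _ => ?_
  simp only [weight, Nat.sub_self, range_zero, prod_empty, mul_one]
  rcases lt_or_gt_of_ne (neg_word_ne π (show 0 < n by omega) hn (by omega)) with h | h
  · simp only [h, h.not_gt, if_true, if_false]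
    ring
  · simp only [h, h.not_gt, if_true, if_false]
    ring

theorem word_flipFirst_zero {n : ℕ} (π : SignedPerm (n + 1)) :
    word (flipFirst π) 0 = -word π 0 := by
  rw [word_of_lt _ (by omega), word_of_lt _ (by omega), val_flipFirst]
  exact if_pos rfl

theorem word_flipFirst_of_ne {n : ℕ} (π : SignedPerm (n + 1)) {i : ℕ} (h : i ≠ 0) :
    word (flipFirst π) i = word π i := by
  unfold word
  split_ifs with hi
  · rw [val_flipFirst, if_neg (by simpa [Fin.ext_iff] using h)]
  · rfl

theorem asc_flipFirst {n : ℕ} (π : SignedPerm (n + 1)) : Asc 1 (flipFirst π) ↔ Asc 1 π := by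
  unfold Asc
  refine forall_congr' fun i => forall_congr' fun j => ?_
  refine forall_congr' fun hi => forall_congr' fun hij => ?_
  rw [word_flipFirst_of_ne π (by omega), word_flipFirst_of_ne π (by omega)]

open scoped Classical in
-- Negating the first entry turns the condition -π_1 < π_2 into π_1 < π_2 and preserves `inv`.
theorem sum_asc_neg [CommSemiring K] (q : K) (n : ℕ) :
    ∑ π : SignedPerm (n + 2) with Asc 1 π ∧ -word π 0 < word π 1, q ^ inv π =
      ∑ π : SignedPerm (n + 2) with Asc 0 π, q ^ inv π := by
  refine sum_nbij' flipFirst flipFirst ?_ ?_ ?_ ?_ ?_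
  · intro π h
    rw [mem_filter] at h ⊢
    refine ⟨mem_univ _, (asc_iff_asc_succ (by omega) _).2 ⟨(asc_flipFirst π).2 h.2.1, ?_⟩⟩
    rw [word_flipFirst_zero, word_flipFirst_of_ne π (by omega)]
    exact h.2.2
  · intro π h
    rw [mem_filter, asc_iff_asc_succ (by omega)] at h
    rw [mem_filter, asc_flipFirst, word_flipFirst_zero, word_flipFirst_of_ne π (by omega), neg_neg]
    exact ⟨mem_univ _, h.2⟩
  · intro π _
    exact flipFirst_flipFirst π
  · intro π _
    exact flipFirst_flipFirst π
  · intro π _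
    rw [inv_flipFirst]

/-- The conditions say |π_1| < π_2 < π_3 < …, so the absolute values increase and only the sign of
π_1 is free. -/
theorem asc_and_neg_iff {n : ℕ} (π : SignedPerm (n + 2)) :
    (Asc 0 π ∧ -word π 0 < word π 1) ↔ π.1 = 1 ∧ ∀ i, i ≠ 0 → π.2 i = 1 := by
  constructor
  · rintro ⟨h, h1⟩
    have hpos : ∀ i : Fin (n + 2), i ≠ 0 → 0 < val π i := by
      intro i hi
      have hi' : 1 ≤ (i : ℕ) := Fin.pos_of_ne_zero hi
      have h2 := h 0 1 (by omega) (by omega) (by omega)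
      rw [← word_fin]
      rcases hi'.eq_or_lt with e | e
      · rw [← e]
        omega
      · have := h 1 i (by omega) e i.2
        omega
    have hval : ∀ i : Fin (n + 2), i ≠ 0 → val π i = ((π.1 i : Fin (n + 2)) : ℤ) + 1 := by
      intro i hi
      rw [← abs_val, abs_of_pos (hpos i hi)]
    constructor
    · have hmono : StrictMono π.1 := by
        intro i j hij
        have hj : j ≠ 0 := (Fin.pos_of_ne_zero (by rintro rfl; simp at hij)).ne'
        rw [Fin.lt_def]
        have h2 := h i j (Nat.zero_le _) hij j.2
        rw [word_fin, word_fin, hval j hj] at h2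
        by_cases hi : i = 0
        · subst hi
          have h3 : -val π 0 < val π j := by
            have hj' : 1 ≤ (j : ℕ) := Fin.pos_of_ne_zero hj
            have h4 : word π 1 ≤ word π j := by
              rcases hj'.eq_or_lt with e | e
              · rw [← e]
              · exact (h 1 j (by omega) e j.2).le
            have h5 : word π 0 = val π 0 := word_fin π 0
            rw [← word_fin π j]
            omega
          rw [hval j hj] at h3
          have := abs_val π 0
          rcases abs_choice (val π 0) with h4 | h4 <;> omega
        · rw [hval i hi] at h2
          omega
      exact Equiv.ext fun i => congrFun hmono.eq_id i
    · intro i hi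
      rcases Int.units_eq_one_or (π.2 i) with e | e
      · exact e
      · have := hpos i hi
        rw [val, e] at this
        simp at this
        omega
  · rintro ⟨h1, h2⟩
    have hval : ∀ i : Fin (n + 2), i ≠ 0 → val π i = (i : ℤ) + 1 := by
      intro i hi
      rw [val, h2 i hi, h1]
      simp
    have h0 : |val π 0| = 1 := by
      rw [abs_val, h1]
      simp
    have hword : ∀ i, 1 ≤ i → i < n + 2 → word π i = i + 1 := by
      intro i h hi
      rw [word_of_lt π hi, hval]
      simp [Fin.ext_iff]
      omega
    have h3 : word π 0 = 1 ∨ word π 0 = -1 := by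
      have h5 : word π 0 = val π 0 := word_fin π 0
      rw [h5]
      exact eq_or_eq_neg_of_abs_eq h0
    refine ⟨fun i j _ hij hj => ?_, ?_⟩
    · rw [hword j (by omega) hj]
      by_cases hi : i = 0
      · subst hi
        omega
      · rw [hword i (by omega) (by omega)]
        omega
    · rw [hword 1 le_rfl (by omega)]
      push_cast
      omega

theorem inv_eq_zero {n : ℕ} (π : SignedPerm (n + 2)) (h : Asc 0 π) (h1 : -word π 0 < word π 1) :
    inv π = 0 := by
  rw [inv_eq_sum]
  refine sum_eq_zero fun i _ => sum_eq_zero fun j _ => ?_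
  split_ifs with hij
  · rw [← word_fin, ← word_fin, pairInv]
    have h2 := h i j (Nat.zero_le _) hij j.2
    have h3 : -word π i < word π j := by
      have h4 : word π 1 ≤ word π j := by
        rcases (show 1 ≤ (j : ℕ) from (Nat.zero_le _).trans_lt hij).eq_or_lt with e | e
        · rw [← e]
        · exact (h 1 j (by omega) e j.2).le
      rcases Nat.eq_zero_or_pos (i : ℕ) with e | e
      · rw [e]
        omega
      · have := h 0 i le_rfl e i.2
        omega
    simp [h2.not_gt, h3.not_gt]
  · rfl

open scoped Classical in
theorem sum_asc_zero_neg [CommSemiring K] (q : K) (n : ℕ) :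
    ∑ π : SignedPerm (n + 2) with Asc 0 π ∧ -word π 0 < word π 1, q ^ inv π = 2 := by
  have h1 : ∑ π : SignedPerm (n + 2) with Asc 0 π ∧ -word π 0 < word π 1, q ^ inv π =
      ∑ π : SignedPerm (n + 2) with Asc 0 π ∧ -word π 0 < word π 1, 1 := by
    refine sum_congr rfl fun π h => ?_
    rw [mem_filter] at h
    rw [inv_eq_zero π h.2.1 h.2.2, pow_zero]
  have h2 : (univ.filter fun π : SignedPerm (n + 2) => Asc 0 π ∧ -word π 0 < word π 1) =
      {(1, 1), flipFirst (1, 1)} := by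
    ext ⟨σ, ε⟩
    rw [mem_filter, asc_and_neg_iff]
    simp only [mem_univ, true_and, mem_insert, mem_singleton, flipFirst, Prod.mk.injEq]
    constructor
    · rintro ⟨rfl, h⟩
      rcases Int.units_eq_one_or (ε 0) with e | e
      · refine Or.inl ⟨rfl, funext fun i => ?_⟩
        by_cases hi : i = 0
        · subst hi
          exact e
        · exact h i hi
      · refine Or.inr ⟨rfl, funext fun i => ?_⟩
        by_cases hi : i = 0
        · subst hi
          simpa using e
        · simpa [hi] using h i hi
    · rintro (⟨rfl, rfl⟩ | ⟨rfl, rfl⟩)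
      · simp
      · refine ⟨rfl, fun i hi => by simp [hi]⟩
  rw [h1, h2, sum_pair]
  · norm_num
  · intro h
    have := congrFun (congrArg Prod.snd h) 0
    simp [flipFirst] at this

/-! ### Nonvanishing normalizers and the return to type D -/

theorem qNumber_two_mul [CommSemiring K] (q : K) (i : ℕ) :
    qNumber q (2 * i) = qNumber q i * (1 + q ^ i) := by
  rw [qNumber, two_mul, sum_range_add, mul_add, mul_one, qNumber, sum_mul]
  congr 1
  exact sum_congr rfl fun j _ => by ring

/-- For i > 0 the factor 1 + q^i divides [2i]_q; for i = 0 it is 2, which is where the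
characteristic enters. -/
theorem sum_inv_ne_zero [Field K] (h2 : (2 : K) ≠ 0) {q : K}
    (hq : ∀ n : ℕ, 1 ≤ n → qNumber q n ≠ 0) (n : ℕ) : ∑ π : SignedPerm n, q ^ inv π ≠ 0 := by
  rw [sum_inv, prod_ne_zero_iff]
  intro i _
  refine mul_ne_zero (hq _ (by omega)) ?_
  rcases Nat.eq_zero_or_pos i with rfl | hi
  · norm_num
    exact h2
  · have := hq (2 * i) (by omega)
    rw [qNumber_two_mul] at this
    exact right_ne_zero_of_mul this

theorem qFactorial_ne_zero [Field K] {q : K} (hq : ∀ n : ℕ, 1 ≤ n → qNumber q n ≠ 0) (n : ℕ) :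
    qFactorial q n ≠ 0 :=
  prod_ne_zero_iff.2 fun i hi => hq i (mem_Icc.1 hi).1

theorem two_mul_D₂_one [CommSemiring K] (q : K) {n : ℕ} (hn : 1 ≤ n) :
    2 * D₂ n 1 q = ∑ π : SignedPerm n, q ^ inv π := by
  obtain ⟨m, rfl⟩ : ∃ m, n = m + 1 := ⟨n - 1, by omega⟩
  rw [sum_typeD _ fun π => by rw [inv_toggleOne]]
  simp [D₂]

theorem D₂_zero [CommSemiring K] (t q : K) : D₂ 0 t q = 1 := by
  rw [D₂, show typeD 0 = {(1, 1)} from ?_, sum_singleton]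
  · have h : DES ((1, 1) : SignedPerm 0) = ∅ := by
      have h0 : ∀ i : ℤ, entry ((1, 1) : SignedPerm 0) i = 0 := fun i => dif_neg (by omega)
      simp [DES, h0]
    simp [des, h, inv]
  · ext π
    rw [mem_typeD_iff]
    simp [Subsingleton.elim π (1, 1)]

theorem D₂_one_ne_zero [Field K] (h2 : (2 : K) ≠ 0) {q : K}
    (hq : ∀ n : ℕ, 1 ≤ n → qNumber q n ≠ 0) (n : ℕ) : D₂ n 1 q ≠ 0 := by
  rcases Nat.eq_zero_or_pos n with rfl | hn
  · simp [D₂_zero]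
  · have := sum_inv_ne_zero h2 hq n
    rw [← two_mul_D₂_one q hn] at this
    exact right_ne_zero_of_mul this

theorem weight_toggleOne [CommSemiring K] (x : ℕ → K) (t : K) {n k : ℕ} (hn : 1 ≤ n)
    (hk : k ≤ n + 1) (π : SignedPerm (n + 1)) :
    weight x t k (toggleOne π) = weight x t k π := by
  have h : ∀ i, i < n → (word (toggleOne π) (i + 1) < word (toggleOne π) i ↔
      word π (i + 1) < word π i) ∧ (word (toggleOne π) (i + 1) < -word (toggleOne π) i ↔
      word π (i + 1) < -word π i) := by
    intro i hi
    rw [word_of_lt _ (by omega : i < n + 1), word_of_lt _ (by omega : i + 1 < n + 1),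
      word_of_lt π (by omega : i < n + 1), word_of_lt π (by omega : i + 1 < n + 1)]
    exact val_toggleOne_lt π (by simp [Fin.ext_iff])
  unfold weight
  simp only [gt_iff_lt, (h 0 (by omega)).2]
  congr 1
  refine prod_congr rfl fun i hi => ?_
  have := mem_range.1 hi
  simp only [(h i (by omega)).1]

theorem two_mul_D₃ [CommSemiring K] (s t q : K) {n : ℕ} (hn : 2 ≤ n) :
    2 * D₃ n s t q =
      ∑ π : SignedPerm n, weight (fun i => if Even i then s else t) t n π * q ^ inv π := by
  obtain ⟨m, rfl⟩ : ∃ m, n = m + 1 := ⟨n - 1, by omega⟩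
  rw [sum_typeD _ fun π => by rw [inv_toggleOne, weight_toggleOne _ _ (by omega) le_rfl]]
  simp only [D₃, prod_DES hn, weight]

/-! ### Assembling the recurrence -/

open scoped Classical in
-- Positions -1 and 1 both carry weight x 1. Expanding both leaves four sums: one over `Asc 1`, two
-- equal to the sum over `Asc 0` (one by `sum_asc_neg`), and one equal to 2, which is the total sum
-- divided by `D₂ n 1 q`.
theorem sum_asc_weight_two [Field K] (h2 : (2 : K) ≠ 0) {q : K}
    (hq : ∀ n : ℕ, 1 ≤ n → qNumber q n ≠ 0) (x : ℕ → K) {n : ℕ} (hn : 2 ≤ n) :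
    ∑ π : SignedPerm n with Asc 1 π, weight x (x 1) 2 π * q ^ inv π =
      (∑ π : SignedPerm n, q ^ inv π) * (x 1 ^ 2 / qFactorial q (n - 1) +
        2 * x 1 * (1 - x 1) / qFactorial q n + (1 - x 1) ^ 2 / D₂ n 1 q) := by
  have hD := D₂_one_ne_zero h2 hq n
  obtain ⟨m, rfl⟩ : ∃ m, n = m + 2 := ⟨n - 2, by omega⟩
  have h0 := sum_asc (n := m + 2) (l := 0) (by omega) q (fun _ => 1) (fun _ _ _ _ => rfl)
  have h1 := sum_asc (n := m + 2) (l := 1) (by omega) q (fun _ => 1) (fun _ _ _ _ => rfl)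
  simp only [one_mul, Nat.sub_zero] at h0 h1
  have hN := two_mul_D₂_one q (n := m + 2) (by omega)
  rw [sum_asc_weight_succ x (x 1) q (m := 0) (by omega), zero_add,
    sum_asc_weight_one x (x 1) q (by omega), sum_asc_weight_one x (x 1) q (by omega),
    sum_asc_neg, sum_asc_zero_neg]
  rw [mul_comm, ← eq_div_iff (qFactorial_ne_zero hq _)] at h0 h1
  have hF := qFactorial_ne_zero hq (m + 2)
  have hF' := qFactorial_ne_zero hq (m + 2 - 1)
  rw [h0, h1, ← hN]
  field_simp
  ring

open scoped Classical in
/-- The expansion of the sum over the signed permutations whose entries increase from position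
`m` on, according to the last descent before that position. -/
theorem sum_asc_weight [Field K] (h2 : (2 : K) ≠ 0) {q : K}
    (hq : ∀ n : ℕ, 1 ≤ n → qNumber q n ≠ 0) (x : ℕ → K) {n m : ℕ} (hm : 1 ≤ m) (hmn : m < n) :
    (∑ π : SignedPerm n with Asc m π, weight x (x 1) (m + 1) π * q ^ inv π) *
        ∏ i ∈ Ioc m n, (1 - x i) =
      (∑ π : SignedPerm n, q ^ inv π) * ((x 1 ^ 2 / qFactorial q (n - 1) +
        2 * x 1 * (1 - x 1) / qFactorial q n + (1 - x 1) ^ 2 / D₂ n 1 q) *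
          ∏ i ∈ Ioc 1 n, (1 - x i) + ∑ k ∈ Ico 2 (m + 1), x k *
          ((∑ π : SignedPerm k, weight x (x 1) k π * q ^ inv π) / ∑ π : SignedPerm k, q ^ inv π) *
            (∏ i ∈ Ioc k n, (1 - x i)) / qFactorial q (n - k)) := by
  induction m, hm using Nat.le_induction with
  | base =>
    rw [sum_asc_weight_two h2 hq x (by omega)]
    simp
    ring
  | succ m hm ih =>
    have ih := ih (by omega)
    have hp : ∏ i ∈ Ioc m n, (1 - x i) = (1 - x (m + 1)) * ∏ i ∈ Ioc (m + 1) n, (1 - x i) := by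
      rw [← prod_Ioc_consecutive _ (show m ≤ m + 1 by omega) hmn.le]
      simp
    -- Together, `hs` and `hw` evaluate the sum with weight of length m + 1 and sorted tail; this is
    -- the new summand k = m + 1.
    have hs := sum_asc (n := n) (l := m + 1) (by omega) q (weight x (x 1) (m + 1))
      (fun p hp π h => weight_swapAt x (x 1) (by omega) p hp π h)
    have hw := sum_weight x (x 1) q (show 2 ≤ m + 1 by omega) hmn.le
    rw [mul_comm, ← eq_div_iff (sum_inv_ne_zero h2 hq _), ← hs, mul_comm,
      ← eq_div_iff (qFactorial_ne_zero hq _)] at hw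
    rw [sum_asc_weight_succ x (x 1) q hmn, sum_Ico_succ_top (by omega), ← add_assoc, mul_add, ← ih,
      hp, hw]
    ring

/-- The recurrence for the normalized type D Eulerian polynomials. -/
theorem D₃_div_D₂ [Field K] (h2 : (2 : K) ≠ 0) {s t q : K}
    (hq : ∀ n : ℕ, 1 ≤ n → qNumber q n ≠ 0) {n : ℕ} (hn : 2 ≤ n) :
    D₃ n s t q / D₂ n 1 q = (t ^ 2 / qFactorial q (n - 1) +
        2 * t * (1 - t) / qFactorial q n + (1 - t) ^ 2 / D₂ n 1 q) *
          ∏ i ∈ Ioc 1 n, (1 - if Even i then s else t) +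
      ∑ k ∈ Icc 2 n, (if Even k then s else t) * (D₃ k s t q / D₂ k 1 q) *
        (∏ i ∈ Ioc k n, (1 - if Even i then s else t)) / qFactorial q (n - k) := by
  classical
  set x : ℕ → K := fun i => if Even i then s else t with hx
  have hx1 : x 1 = t := by simp [hx]
  have hr : ∀ k, 2 ≤ k → D₃ k s t q / D₂ k 1 q =
      (∑ π : SignedPerm k, weight x (x 1) k π * q ^ inv π) / ∑ π : SignedPerm k, q ^ inv π := by
    intro k hk
    rw [hx1, ← two_mul_D₃ s t q hk, ← two_mul_D₂_one q (by omega), mul_div_mul_left _ _ h2]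
  have h := sum_asc_weight h2 hq x (show 1 ≤ n - 1 by omega) (by omega : n - 1 < n)
  -- A tail of length one is always increasing, so the sorted sum is the full sum.
  have ha : ∀ π : SignedPerm n, Asc (n - 1) π := fun π i j h1 h2 h3 => by omega
  simp only [ha, filter_true, show n - 1 + 1 = n by omega] at h
  rw [show Ioc (n - 1) n = {n} from ?_, prod_singleton] at h
  · have hN := sum_inv_ne_zero h2 hq n
    have he : ∑ k ∈ Ico 2 n, x k * (D₃ k s t q / D₂ k 1 q) * (∏ i ∈ Ioc k n, (1 - x i)) /
        qFactorial q (n - k) = ∑ k ∈ Ico 2 n, x k *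
          ((∑ π : SignedPerm k, weight x (x 1) k π * q ^ inv π) / ∑ π : SignedPerm k, q ^ inv π) *
            (∏ i ∈ Ioc k n, (1 - x i)) / qFactorial q (n - k) :=
      sum_congr rfl fun k hk => by rw [hr k (mem_Ico.1 hk).1]
    rw [← he, (div_eq_iff hN).1 (hr n hn).symm, mul_right_comm, mul_comm] at h
    have h' := mul_left_cancel₀ hN h
    -- So far the left side carries the factor 1 - x n; the summand k = n supplies the missing x n
    -- times the same ratio.
    rw [← Ico_insert_right hn, sum_insert (by simp), Ioc_self, prod_empty, Nat.sub_self,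
      show qFactorial q 0 = 1 by simp [qFactorial], ← hx1]
    rw [hx1] at h' ⊢
    linear_combination h'
  · ext i
    simp
    omega

end TypeDEulerian

namespace TypeDEulerian

open Finset PowerSeries

variable {K : Type*} [Field K]

/-! ### Generating functions -/

theorem coeff_even_part (h2 : (2 : K) ≠ 0) (f : K⟦X⟧) (M : K) (n : ℕ) :
    coeff n (rescale M (C (1 / 2 : K) * (f + rescale (-1) f))) =
      if Even n then M ^ n * coeff n f else 0 := by
  rw [coeff_rescale, coeff_C_mul, map_add, coeff_rescale]
  split_ifs with h
  · rw [h.neg_one_pow]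
    field_simp
    ring
  · rw [(Nat.not_even_iff_odd.1 h).neg_one_pow]
    ring

theorem coeff_odd_part (h2 : (2 : K) ≠ 0) (f : K⟦X⟧) (M : K) (n : ℕ) :
    coeff n (rescale M (C (1 / 2 : K) * (f - rescale (-1) f))) =
      if Odd n then M ^ n * coeff n f else 0 := by
  rw [coeff_rescale, coeff_C_mul, map_sub, coeff_rescale]
  split_ifs with h
  · rw [h.neg_one_pow]
    field_simp
    ring
  · rw [(Nat.not_odd_iff_even.1 h).neg_one_pow]
    ring

theorem coeff_coshq (h2 : (2 : K) ≠ 0) (q M : K) (n : ℕ) :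
    coeff n (rescale M (coshq q)) = if Even n then M ^ n / qFactorial q n else 0 := by
  rw [coshq, coeff_even_part h2, expq, coeff_mk, mul_one_div]

theorem coeff_sinhq (h2 : (2 : K) ≠ 0) (q M : K) (n : ℕ) :
    coeff n (rescale M (sinhq q)) = if Odd n then M ^ n / qFactorial q n else 0 := by
  rw [sinhq, coeff_odd_part h2, expq, coeff_mk, mul_one_div]

theorem coeff_coshD (h2 : (2 : K) ≠ 0) (q M : K) (n : ℕ) :
    coeff n (rescale M (coshD q)) = if Even n then M ^ n / D₂ n 1 q else 0 := by
  rw [coshD, coeff_even_part h2, expD, coeff_mk, mul_one_div]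

theorem coeff_sinhD (h2 : (2 : K) ≠ 0) (q M : K) (n : ℕ) :
    coeff n (rescale M (sinhD q)) = if Odd n then M ^ n / D₂ n 1 q else 0 := by
  rw [sinhD, coeff_odd_part h2, expD, coeff_mk, mul_one_div]

theorem qFactorial_zero (q : K) : qFactorial q 0 = 1 := by simp [qFactorial]

theorem qFactorial_one (q : K) : qFactorial q 1 = 1 := by simp [qFactorial, qNumber]

theorem D₂_one_one (h2 : (2 : K) ≠ 0) (q : K) : D₂ 1 1 q = 1 := by
  have h := two_mul_D₂_one q (le_refl 1)
  rw [sum_inv, prod_range_one] at h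
  norm_num [qNumber] at h
  exact mul_left_cancel₀ h2 (by rw [h]; norm_num)

theorem coeff_mul_of_coeff_eq_zero {f g : K⟦X⟧} (hf : ∀ k < 2, coeff k f = 0) (n : ℕ) :
    coeff n (f * g) = ∑ k ∈ Icc 2 n, coeff k f * coeff (n - k) g := by
  rw [coeff_mul, Nat.sum_antidiagonal_eq_sum_range_succ fun i j => coeff i f * coeff j g]
  symm
  refine sum_subset (fun k hk => ?_) fun k _ hk' => ?_
  · simp only [mem_Icc, mem_range] at hk ⊢
    omega
  · simp only [mem_Icc, mem_range, not_and, not_le] at *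
    rw [hf k (by omega), zero_mul]

theorem coeff_ED (h2 : (2 : K) ≠ 0) (s t q M : K) {n : ℕ} (hn : Even n) (hn2 : 2 ≤ n) :
    coeff n (ED s t q M) = 2 * t * (M ^ n / qFactorial q n) + (1 - t) * (M ^ n / D₂ n 1 q) +
      t ^ 2 * (1 - s) / M * (M ^ (n - 1) / qFactorial q (n - 1)) := by
  obtain ⟨m, rfl⟩ : ∃ m, n = m + 1 := ⟨n - 1, by omega⟩
  have ho : Odd m := by
    rw [← Nat.not_even_iff_odd]
    exact Nat.even_add_one.1 hn
  rw [ED, mul_assoc X, map_add, map_add, coeff_succ_X_mul, coeff_C_mul, coeff_C_mul, coeff_C_mul,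
    map_sub, map_sub, coeff_coshq h2, coeff_coshD h2, coeff_sinhq h2, coeff_one,
    if_pos hn, if_pos hn, if_pos ho, if_neg (by omega)]
  simp

theorem coeff_OD (h2 : (2 : K) ≠ 0) (s t q M : K) {n : ℕ} (hn : Odd n) (hn2 : 3 ≤ n) :
    coeff n (OD s t q M) = t ^ 2 * (M ^ (n - 1) / qFactorial q (n - 1)) +
      (1 - t) * M / (1 - s) * (M ^ n / D₂ n 1 q) +
      2 * t * (1 - t) / M * (M ^ n / qFactorial q n) := by
  obtain ⟨m, rfl⟩ : ∃ m, n = m + 1 := ⟨n - 1, by omega⟩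
  have he : Even m := by
    rw [← Nat.not_odd_iff_even]
    exact Nat.odd_add_one.1 hn
  rw [OD, mul_assoc X, map_add, map_add, coeff_succ_X_mul, coeff_C_mul, coeff_C_mul, coeff_C_mul,
    map_sub, map_sub, map_sub, coeff_C_mul, coeff_X, coeff_coshq h2, coeff_sinhD h2,
    coeff_sinhq h2, coeff_one, if_pos hn, if_pos hn, if_pos he, if_neg (by omega),
    if_neg (by omega)]
  simp

theorem coeff_ED_eq_zero (h2 : (2 : K) ≠ 0) (s t q M : K) {n : ℕ} (hn : ¬(Even n ∧ 2 ≤ n)) :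
    coeff n (ED s t q M) = 0 := by
  rcases Nat.eq_zero_or_pos n with rfl | h
  · rw [ED, mul_assoc X, map_add, map_add, coeff_zero_X_mul, coeff_C_mul, coeff_C_mul,
      map_sub, map_sub, coeff_coshq h2, coeff_coshD h2]
    simp [qFactorial_zero, D₂_zero]
  · obtain ⟨m, rfl⟩ : ∃ m, n = m + 1 := ⟨n - 1, by omega⟩
    have hn' : ¬ Even (m + 1) := fun e => hn ⟨e, by rcases e with ⟨r, hr⟩; omega⟩
    have ho : ¬ Odd m := by
      rw [Nat.not_odd_iff_even]
      by_contra hc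
      exact hn' (Nat.even_add_one.2 hc)
    rw [ED, mul_assoc X, map_add, map_add, coeff_succ_X_mul, coeff_C_mul, coeff_C_mul, coeff_C_mul,
      map_sub, map_sub, coeff_coshq h2, coeff_coshD h2, coeff_sinhq h2, coeff_one,
      if_neg hn', if_neg hn', if_neg ho, if_neg (by omega)]
    simp

theorem coeff_OD_eq_zero (h2 : (2 : K) ≠ 0) (s t q M : K) {n : ℕ} (hn : ¬(Odd n ∧ 3 ≤ n)) :
    coeff n (OD s t q M) = 0 := by
  rcases Nat.eq_zero_or_pos n with rfl | h
  · rw [OD, mul_assoc X, map_add, map_add, coeff_zero_X_mul, coeff_C_mul, coeff_C_mul,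
      map_sub, map_sub, coeff_sinhD h2, coeff_sinhq h2, coeff_C_mul, coeff_X]
    simp
  · obtain ⟨m, rfl⟩ : ∃ m, n = m + 1 := ⟨n - 1, by omega⟩
    rw [OD, mul_assoc X, map_add, map_add, coeff_succ_X_mul, coeff_C_mul, coeff_C_mul, coeff_C_mul,
      map_sub, map_sub, map_sub, coeff_C_mul, coeff_X, coeff_coshq h2, coeff_sinhD h2,
      coeff_sinhq h2, coeff_one]
    rcases Nat.eq_zero_or_pos m with rfl | hm
    · simp [qFactorial_zero, qFactorial_one, D₂_one_one h2]
    · have hn' : ¬ Odd (m + 1) := fun e => hn ⟨e, by rcases e with ⟨r, hr⟩; omega⟩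
      have ho : ¬ Even m := by
        rw [Nat.not_even_iff_odd]
        by_contra hc
        exact hn' (Nat.odd_add_one.2 hc)
      rw [if_neg hn', if_neg hn', if_neg ho, if_neg (by omega), if_neg (by omega)]
      simp

/-- Consecutive indices have opposite parity, so each pair of factors is (1 - s)(1 - t) = M². -/
theorem prod_Ioc_of_even {s t M : K} (hM : M ^ 2 = (1 - s) * (1 - t)) (k r : ℕ) :
    ∏ i ∈ Ioc k (k + 2 * r), (1 - if Even i then s else t) = M ^ (2 * r) := by
  induction r with
  | zero => simp
  | succ r ih =>
    rw [show k + 2 * (r + 1) = k + 2 * r + 1 + 1 by ring, prod_Ioc_succ_top (by omega),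
      prod_Ioc_succ_top (by omega), ih, mul_add, pow_add, mul_assoc, mul_one, hM]
    congr 1
    by_cases h : Even (k + 2 * r + 1)
    · simp only [Nat.even_add_one (n := k + 2 * r + 1), h, not_true_eq_false, if_true, if_false]
    · simp only [Nat.even_add_one (n := k + 2 * r + 1), h, not_false_eq_true, if_true, if_false]
      ring

theorem prod_Ioc_of_odd {s t M : K} (hM : M ^ 2 = (1 - s) * (1 - t)) (k r : ℕ) :
    ∏ i ∈ Ioc k (k + 2 * r + 1), (1 - if Even i then s else t) =
      M ^ (2 * r) * (1 - if Even (k + 1) then s else t) := by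
  rw [prod_Ioc_succ_top (by omega), prod_Ioc_of_even hM]
  have : Even (k + 2 * r + 1) ↔ Even (k + 1) := by
    simp [Nat.even_add_one, Nat.even_add]
  simp only [this]

/-- In the recurrence at even n, an even k gives s M^(n-k), a cosh_q term; an odd k gives t (1 - s)
M^(n-k-1), a sinh_q term after dividing by M. -/
theorem egfEven_eq (h2 : (2 : K) ≠ 0) {s t q M : K} (hs : s ≠ 1) (ht : t ≠ 1)
    (hq : ∀ n : ℕ, 1 ≤ n → qNumber q n ≠ 0) (hM : M ^ 2 = (1 - s) * (1 - t)) :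
    egfEven s t q = ED s t q M + C s * (egfEven s t q * rescale M (coshq q)) +
      C (t * (1 - s) / M) * (egfOdd s t q * rescale M (sinhq q)) := by
  have hs' : 1 - s ≠ 0 := sub_ne_zero.2 hs.symm
  have ht' : 1 - t ≠ 0 := sub_ne_zero.2 ht.symm
  have hM0 : M ≠ 0 := by
    rintro rfl
    exact mul_ne_zero hs' ht' (by rw [← hM]; ring)
  ext n
  rw [map_add, map_add, coeff_C_mul, coeff_C_mul,
    coeff_mul_of_coeff_eq_zero (by intro k hk; rw [egfEven, coeff_mk, if_neg (by omega)]),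
    coeff_mul_of_coeff_eq_zero (by intro k hk; rw [egfOdd, coeff_mk, if_neg (by omega)]),
    mul_sum, mul_sum, add_assoc, ← sum_add_distrib]
  simp only [coeff_coshq h2, coeff_sinhq h2, egfEven, egfOdd, coeff_mk]
  by_cases hn : Even n ∧ 2 ≤ n
  · rw [if_pos hn, D₃_div_D₂ h2 hq hn.2, coeff_ED h2 s t q M hn.1 hn.2]
    congr 1
    · obtain ⟨r, hr⟩ := hn.1
      obtain ⟨m, rfl⟩ : ∃ m, n = 1 + 2 * m + 1 := ⟨r - 1, by omega⟩
      rw [prod_Ioc_of_odd hM, if_pos (by decide)]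
      have hF := qFactorial_ne_zero hq (1 + 2 * m + 1)
      have hF' := qFactorial_ne_zero hq (1 + 2 * m + 1 - 1)
      have hD := D₂_one_ne_zero h2 hq (1 + 2 * m + 1)
      have e1 : M ^ (1 + 2 * m + 1) = M ^ (2 * m) * ((1 - s) * (1 - t)) := by
        rw [← hM]
        ring
      have e2 : M ^ (1 + 2 * m + 1 - 1) = M ^ (2 * m) * M := by
        rw [← pow_succ]
        congr 1
        omega
      rw [e1, e2]
      field_simp
      ring
    · refine sum_congr rfl fun k hk => ?_
      rw [mem_Icc] at hk
      have hF := qFactorial_ne_zero hq (n - k)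
      rcases Nat.even_or_odd k with he | ho
      · have h1 : Even (n - k) := (Nat.even_sub hk.2).2 (by simp [hn.1, he])
        obtain ⟨r, hr⟩ := h1
        obtain rfl : n = k + 2 * r := by omega
        rw [prod_Ioc_of_even hM, if_pos he, if_pos ⟨he, hk.1⟩, if_pos (by simp),
          if_neg (fun h => Nat.not_even_iff_odd.2 h.1 he), Nat.add_sub_cancel_left]
        ring
      · have h1 : ¬ Even (n - k) := by
          rw [Nat.even_sub hk.2]
          simp [hn.1, Nat.not_even_iff_odd.2 ho]
        -- The sum starts at k = 2, so odd indices start at 3, as in `egfOdd`.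
        have h3 : 3 ≤ k := by
          obtain ⟨a, ha⟩ := ho
          omega
        obtain ⟨r, hr⟩ := Nat.not_even_iff_odd.1 h1
        obtain rfl : n = k + 2 * r + 1 := by omega
        rw [prod_Ioc_of_odd hM, if_pos ho.add_one, if_neg (Nat.not_even_iff_odd.2 ho),
          if_neg (fun h => Nat.not_even_iff_odd.2 ho h.1), if_neg h1,
          if_pos (Nat.not_even_iff_odd.1 h1), if_pos ⟨ho, h3⟩,
          show k + 2 * r + 1 - k = 2 * r + 1 by omega]
        field_simp
        ring
  · rw [if_neg hn, coeff_ED_eq_zero h2 s t q M hn, zero_add]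
    symm
    refine sum_eq_zero fun k hk => ?_
    rw [mem_Icc] at hk
    have hn' : ¬ Even n := fun h => hn ⟨h, by omega⟩
    rcases Nat.even_or_odd k with he | ho
    · have h1 : ¬ Even (n - k) := by
        rw [Nat.even_sub hk.2]
        simp [hn', he]
      rw [if_neg h1, if_neg fun h : Odd k ∧ 3 ≤ k => Nat.not_even_iff_odd.2 h.1 he]
      ring
    · have h1 : Even (n - k) := by
        rw [Nat.even_sub hk.2]
        simp [hn', ho]
      rw [if_neg fun h => Nat.not_even_iff_odd.2 ho h.1, if_neg (Nat.not_odd_iff_even.2 h1)]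
      ring

theorem egfOdd_eq (h2 : (2 : K) ≠ 0) {s t q M : K} (hs : s ≠ 1) (ht : t ≠ 1)
    (hq : ∀ n : ℕ, 1 ≤ n → qNumber q n ≠ 0) (hM : M ^ 2 = (1 - s) * (1 - t)) :
    egfOdd s t q = OD s t q M + C t * (egfOdd s t q * rescale M (coshq q)) +
      C (s * (1 - t) / M) * (egfEven s t q * rescale M (sinhq q)) := by
  have hs' : 1 - s ≠ 0 := sub_ne_zero.2 hs.symm
  have ht' : 1 - t ≠ 0 := sub_ne_zero.2 ht.symm
  have hM0 : M ≠ 0 := by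
    rintro rfl
    exact mul_ne_zero hs' ht' (by rw [← hM]; ring)
  ext n
  rw [map_add, map_add, coeff_C_mul, coeff_C_mul,
    coeff_mul_of_coeff_eq_zero (by intro k hk; rw [egfOdd, coeff_mk, if_neg (by omega)]),
    coeff_mul_of_coeff_eq_zero (by intro k hk; rw [egfEven, coeff_mk, if_neg (by omega)]),
    mul_sum, mul_sum, add_assoc, ← sum_add_distrib]
  simp only [coeff_coshq h2, coeff_sinhq h2, egfEven, egfOdd, coeff_mk]
  by_cases hn : Odd n ∧ 3 ≤ n
  · have hne : ¬ Even n := Nat.not_even_iff_odd.2 hn.1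
    rw [if_pos hn, D₃_div_D₂ h2 hq (by omega), coeff_OD h2 s t q M hn.1 hn.2]
    congr 1
    · obtain ⟨r, hr⟩ := hn.1
      obtain ⟨m, rfl⟩ : ∃ m, n = 1 + 2 * (m + 1) := ⟨r - 1, by omega⟩
      rw [prod_Ioc_of_even hM]
      have hF := qFactorial_ne_zero hq (1 + 2 * (m + 1))
      have hF' := qFactorial_ne_zero hq (1 + 2 * (m + 1) - 1)
      have hD := D₂_one_ne_zero h2 hq (1 + 2 * (m + 1))
      have e1 : M ^ (1 + 2 * (m + 1)) = M ^ (2 * (m + 1)) * M := by ring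
      have e2 : M ^ (1 + 2 * (m + 1) - 1) = M ^ (2 * (m + 1)) := by
        congr 1
        omega
      -- Exposes M², whose value cancels 1 - s and leaves the term (1 - t)² M^(n-1) of the
      -- recurrence.
      have e3 : (1 - t) * M / (1 - s) * (M ^ (2 * (m + 1)) * M / D₂ (1 + 2 * (m + 1)) 1 q) =
          (1 - t) * M ^ (2 * (m + 1)) / (1 - s) * M ^ 2 / D₂ (1 + 2 * (m + 1)) 1 q := by ring
      rw [e1, e2, e3, hM]
      field_simp
      ring
    · refine sum_congr rfl fun k hk => ?_
      rw [mem_Icc] at hk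
      have hF := qFactorial_ne_zero hq (n - k)
      rcases Nat.even_or_odd k with he | ho
      · have h1 : ¬ Even (n - k) := by
          rw [Nat.even_sub hk.2]
          simp [hne, he]
        obtain ⟨r, hr⟩ := Nat.not_even_iff_odd.1 h1
        obtain rfl : n = k + 2 * r + 1 := by omega
        rw [prod_Ioc_of_odd hM, if_neg (Nat.not_even_iff_odd.2 he.add_one), if_pos he,
          if_neg (fun h => Nat.not_even_iff_odd.2 h.1 he), if_neg h1,
          if_pos (Nat.not_even_iff_odd.1 h1), if_pos ⟨he, hk.1⟩,
          show k + 2 * r + 1 - k = 2 * r + 1 by omega]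
        field_simp
        ring
      · have h1 : Even (n - k) := by
          rw [Nat.even_sub hk.2]
          simp [hne, ho]
        have h3 : 3 ≤ k := by
          obtain ⟨a, ha⟩ := ho
          omega
        obtain ⟨r, hr⟩ := h1
        obtain rfl : n = k + 2 * r := by omega
        rw [prod_Ioc_of_even hM, if_neg (Nat.not_even_iff_odd.2 ho), if_pos ⟨ho, h3⟩,
          if_pos (by simp), if_neg (fun h => Nat.not_even_iff_odd.2 ho h.1),
          Nat.add_sub_cancel_left]
        ring
  · rw [if_neg hn, coeff_OD_eq_zero h2 s t q M hn, zero_add]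
    symm
    refine sum_eq_zero fun k hk => ?_
    rw [mem_Icc] at hk
    rcases Nat.even_or_odd k with he | ho
    · by_cases hne : Even n
      · have h1 : Even (n - k) := by
          rw [Nat.even_sub hk.2]
          simp [hne, he]
        rw [if_neg fun h => Nat.not_even_iff_odd.2 h.1 he, if_neg (Nat.not_odd_iff_even.2 h1)]
        ring
      · obtain ⟨a, ha⟩ := Nat.not_even_iff_odd.1 hne
        exact absurd ⟨Nat.not_even_iff_odd.1 hne, by omega⟩ hn
    · have hne : Even n := by
        by_contra hc
        obtain ⟨a, ha⟩ := ho
        exact hn ⟨Nat.not_even_iff_odd.1 hc, by omega⟩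
      have h1 : ¬ Even (n - k) := by
        rw [Nat.even_sub hk.2]
        simp [hne, ho]
      rw [if_neg h1, if_neg fun h : Even k ∧ 2 ≤ k => Nat.not_even_iff_odd.2 ho h.1]
      ring

/-! ### The determinant of the system and its solution -/

/-- Since e_q(Mu) e_q(-Mu) = cosh_q² - sinh_q², the denominator is the determinant of the linear
system. -/
theorem den_eq (h2 : (2 : K) ≠ 0) (s t q M : K) :
    den s t q M = (1 - C s * rescale M (coshq q)) * (1 - C t * rescale M (coshq q)) -
      C (s * t) * rescale M (sinhq q) ^ 2 := by
  have h1 : rescale M (coshq q) + rescale M (sinhq q) = rescale M (expq q) := by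
    ext n
    rw [map_add, coeff_coshq h2, coeff_sinhq h2, coeff_rescale, expq, coeff_mk]
    rcases Nat.even_or_odd n with h | h
    · rw [if_pos h, if_neg (Nat.not_odd_iff_even.2 h)]
      ring
    · rw [if_pos h, if_neg (Nat.not_even_iff_odd.2 h)]
      ring
  have h3 : rescale M (coshq q) - rescale M (sinhq q) = rescale (-M) (expq q) := by
    ext n
    rw [map_sub, coeff_coshq h2, coeff_sinhq h2, coeff_rescale, expq, coeff_mk]
    rcases Nat.even_or_odd n with h | h
    · rw [if_pos h, if_neg (Nat.not_odd_iff_even.2 h), h.neg_pow]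
      ring
    · rw [if_pos h, if_neg (Nat.not_even_iff_odd.2 h), h.neg_pow]
      ring
  rw [den, ← h1, ← h3, map_add, map_mul]
  ring

theorem constantCoeff_den (h2 : (2 : K) ≠ 0) (s t q M : K) :
    constantCoeff (den s t q M) = (1 - s) * (1 - t) := by
  have h1 : constantCoeff (rescale M (coshq q)) = 1 := by
    rw [← coeff_zero_eq_constantCoeff_apply, coeff_coshq h2]
    simp [qFactorial_zero]
  have h3 : constantCoeff (rescale M (sinhq q)) = 0 := by
    rw [← coeff_zero_eq_constantCoeff_apply, coeff_sinhq h2]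
    simp
  rw [den_eq h2]
  simp [h1, h3]

end TypeDEulerian

theorem mainTheorem3 {K : Type*} [Field K] (h2 : (2 : K) ≠ 0) (s t q M : K)
    (hs : s ≠ 1) (ht : t ≠ 1) (hq : ∀ n : ℕ, 1 ≤ n → TypeDEulerian.qNumber q n ≠ 0)
    (hM : M ^ 2 = (1 - s) * (1 - t)) :
    (∀ n : ℕ, TypeDEulerian.D₂ n 1 q ≠ 0) ∧
    PowerSeries.constantCoeff (TypeDEulerian.den s t q M) ≠ 0 ∧
    TypeDEulerian.egfEven s t q =
      (TypeDEulerian.ED s t q M *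
          (1 - PowerSeries.C t * PowerSeries.rescale M (TypeDEulerian.coshq q)) +
        TypeDEulerian.OD s t q M *
          (PowerSeries.C (t * (1 - s) / M) * PowerSeries.rescale M (TypeDEulerian.sinhq q))) *
        (TypeDEulerian.den s t q M)⁻¹ ∧
    TypeDEulerian.egfOdd s t q =
      (TypeDEulerian.OD s t q M *
          (1 - PowerSeries.C s * PowerSeries.rescale M (TypeDEulerian.coshq q)) +
        TypeDEulerian.ED s t q M *
          (PowerSeries.C (s * (1 - t) / M) * PowerSeries.rescale M (TypeDEulerian.sinhq q))) *
        (TypeDEulerian.den s t q M)⁻¹ := by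
  have hs' : 1 - s ≠ 0 := sub_ne_zero.2 hs.symm
  have ht' : 1 - t ≠ 0 := sub_ne_zero.2 ht.symm
  have hM0 : M ≠ 0 := by
    rintro rfl
    exact mul_ne_zero hs' ht' (by rw [← hM]; ring)
  have hden : PowerSeries.constantCoeff (TypeDEulerian.den s t q M) ≠ 0 := by
    rw [TypeDEulerian.constantCoeff_den h2]
    exact mul_ne_zero hs' ht'
  have hE := TypeDEulerian.egfEven_eq h2 hs ht hq hM
  have hO := TypeDEulerian.egfOdd_eq h2 hs ht hq hM
  -- The off-diagonal coefficients multiply to s t because M² = (1 - s)(1 - t).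
  have hC : (PowerSeries.C (t * (1 - s) / M) * PowerSeries.C (s * (1 - t) / M) : PowerSeries K) =
      PowerSeries.C (s * t) := by
    rw [← map_mul]
    congr 1
    field_simp
    rw [hM]
    ring
  refine ⟨TypeDEulerian.D₂_one_ne_zero h2 hq, hden, ?_, ?_⟩
  · rw [PowerSeries.eq_mul_inv_iff_mul_eq hden, TypeDEulerian.den_eq h2, ← hC]
    -- Cramer's rule: the multipliers are a row of the adjugate matrix, which eliminates `egfOdd`.
    linear_combination (1 - PowerSeries.C t * PowerSeries.rescale M (TypeDEulerian.coshq q)) * hE +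
      (PowerSeries.C (t * (1 - s) / M) * PowerSeries.rescale M (TypeDEulerian.sinhq q)) * hO
  · rw [PowerSeries.eq_mul_inv_iff_mul_eq hden, TypeDEulerian.den_eq h2, ← hC]
    linear_combination (1 - PowerSeries.C s * PowerSeries.rescale M (TypeDEulerian.coshq q)) * hO +
      (PowerSeries.C (s * (1 - t) / M) * PowerSeries.rescale M (TypeDEulerian.sinhq q)) * hE
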